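/- Call $f:\mathbb{R}\to\mathbb{C}$ almost periodic if it is continuous and every real sequence $(t_n)$ has a subsequence $(t_{n_k})$ such that the functions $t\mapsto f(t+t_{n_k})$ converge uniformly on $\mathbb{R}$. For such $f$ the limit $$\lim_{T\to\infty}\frac1T\int_a^{a+T} f(t)e^{-i\lambda t}\,dt$$ exists for all $\lambda,a\in\mathbb{R}$ and does not depend on $a$; the exponents of $f$ are the $\lambda\in\mathbb{R}$ for which it is nonzero. Let $\mathcal{M}(f)$ be the additive subgroup of $\mathbb{R}$ generated by the exponents of $f$, and $\mathcal{M}(f,g)$ the additive subgroup of $\mathbb{R}$ generated by the exponents of $f$ together with those of $g$. **Proposition.** Let $f,g,h:\mathbb{R}\to\mathbb{C}$ be almost periodic. Then $\mathcal{M}(h)\subseteq\mathcal{M}(f,g)$ if and only if, for every real sequence $(t_n)$ such that $(f(\cdot+t_n))$ and $(g(\cdot+t_n))$ both converge uniformly on $\mathbb{R}$, the sequence $(h(\cdot+t_n))$ also converges uniformly on $\mathbb{R}$. -/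

import Mathlib

open Filter Topology

/-- The sequence of translates `t ↦ f (t + s n)` converges uniformly on `ℝ`
to some limit function. -/
def TranslatesConverge (f : ℝ → ℂ) (s : ℕ → ℝ) : Prop :=
  ∃ F : ℝ → ℂ, TendstoUniformly (fun (n : ℕ) (t : ℝ) => f (t + s n)) F atTop

/-- (Uniformly) almost periodic functions `ℝ → ℂ`, in Bochner's form: continuous functions such that
every sequence of translates has a uniformly convergent subsequence. -/
structure IsAlmostPeriodic (f : ℝ → ℂ) : Prop where
  continuous : Continuous f
  exists_subseq : ∀ s : ℕ → ℝ, ∃ φ : ℕ → ℕ, StrictMono φ ∧ TranslatesConverge f (s ∘ φ)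

/-- The set of exponents of `f`: the real `lam` for which the mean value
`lim_{T → ∞} (1 / T) ∫_a^{a+T} f(t) e^{-i lam t} dt` (which, for almost periodic `f`, exists for
every `a` and does not depend on `a`) is nonzero. -/
def exponentSet (f : ℝ → ℂ) : Set ℝ :=
  {lam : ℝ | ∃ c : ℂ, c ≠ 0 ∧ ∀ a : ℝ,
    Tendsto (fun T : ℝ =>
        (1 / (T : ℂ)) * ∫ t in a..(a + T), f t * Complex.exp (-(Complex.I * (lam : ℂ) * (t : ℂ))))
      atTop (𝓝 c)}

/-- The module of `f`: the additive subgroup of `ℝ` generated by the exponents of `f`. -/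
def freqModule (f : ℝ → ℂ) : AddSubgroup ℝ :=
  AddSubgroup.closure (exponentSet f)

/-- The module of the pair `f, g`: the additive subgroup of `ℝ` generated by the exponents of `f`
together with the exponents of `g`. -/
def freqModulePair (f g : ℝ → ℂ) : AddSubgroup ℝ :=
  AddSubgroup.closure (exponentSet f ∪ exponentSet g)

/-! For almost periodic f, the seminorm p_f(t) = sup_x |f(x+t) - f(x)| on ℝ is continuous and
precompact. Hence the Hausdorff completion of ℝ for p_f, or for p_f + p_g, is a compact abelian
group K, and functions uniformly continuous for the seminorm extend continuously to K. Characters of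
K separate points (`exists_character_ne_one`, a Peter–Weyl argument) and pull back to exponentials
on ℝ (`exists_eq_expChar`), so Stone–Weierstrass makes f a uniform limit of trigonometric
polynomials. Averaging f(x + ·) against a trigonometric polynomial close to a tent around 0 then
leaves only exponents of f as frequencies (`IsAlmostPeriodic.trigApprox_freqModule`).

Forward direction: uniform convergence of f(· + s_n) forces exp(iλ s_n) to converge for each
exponent λ of f; likewise for g, hence for every λ in the generated group. Approximating h by
trigonometric polynomials with frequencies in that group gives convergence of its translates.

Converse: the hypothesis makes h uniformly continuous for p_f + p_g, so h extends to the completion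
K. The continuous functions on K that restrict to limits of trigonometric polynomials with
frequencies in M(f,g) form a star-subalgebra containing the extensions of all translates of f and g.
These separate points because the metric of K comes from p_f + p_g. By Stone–Weierstrass h is itself
such a limit, so its exponents lie in M(f,g). -/

/-- The character `t ↦ exp (i l t)` of the real line. -/
noncomputable def expChar (l t : ℝ) : ℂ := Complex.exp (Complex.I * l * t)

theorem continuous_expChar (l : ℝ) : Continuous (expChar l) := by
  unfold expChar; fun_prop

@[simp] theorem norm_expChar (l t : ℝ) : ‖expChar l t‖ = 1 := by
  unfold expChar
  rw [mul_assoc, mul_comm, ← Complex.ofReal_mul]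
  exact Complex.norm_exp_ofReal_mul_I _

theorem expChar_add_left (l m t : ℝ) : expChar (l + m) t = expChar l t * expChar m t := by
  unfold expChar; rw [← Complex.exp_add]; push_cast; ring_nf

theorem expChar_add_right (l s t : ℝ) : expChar l (s + t) = expChar l s * expChar l t := by
  unfold expChar; rw [← Complex.exp_add]; push_cast; ring_nf

@[simp] theorem expChar_zero_left (t : ℝ) : expChar 0 t = 1 := by simp [expChar]

theorem expChar_neg_mul_self (l t : ℝ) : expChar (-l) t * expChar l t = 1 := by
  rw [← expChar_add_left]; simp

theorem star_expChar (l t : ℝ) : star (expChar l t) = expChar (-l) t := by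
  unfold expChar
  rw [Complex.star_def, ← Complex.exp_conj]
  simp

/-! ### Mean values -/

/-- `c` is the mean value of `F`, computed from every starting point. -/
def HasMean (F : ℝ → ℂ) (c : ℂ) : Prop :=
  ∀ a : ℝ, Tendsto (fun T : ℝ => (1 / (T : ℂ)) * ∫ t in a..(a + T), F t) atTop (𝓝 c)

theorem mem_exponentSet_iff {f : ℝ → ℂ} {l : ℝ} :
    l ∈ exponentSet f ↔ ∃ c : ℂ, c ≠ 0 ∧ HasMean (fun t => f t * expChar (-l) t) c := by
  simp [exponentSet, HasMean, expChar]

theorem HasMean.add {F G : ℝ → ℂ} {c d : ℂ} (hF : Continuous F) (hG : Continuous G)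
    (h : HasMean F c) (h' : HasMean G d) : HasMean (fun t => F t + G t) (c + d) := by
  intro a
  refine ((h a).add (h' a)).congr fun T => ?_
  rw [intervalIntegral.integral_add (hF.intervalIntegrable _ _) (hG.intervalIntegrable _ _),
    mul_add]

theorem HasMean.const_mul {F : ℝ → ℂ} {c : ℂ} (h : HasMean F c) (k : ℂ) :
    HasMean (fun t => k * F t) (k * c) := by
  intro a
  refine ((h a).const_mul k).congr fun T => ?_
  rw [intervalIntegral.integral_const_mul]; ring

theorem HasMean.sub {F G : ℝ → ℂ} {c d : ℂ} (hF : Continuous F) (hG : Continuous G)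
    (h : HasMean F c) (h' : HasMean G d) : HasMean (fun t => F t - G t) (c - d) := by
  have := h.add hF (continuous_const.mul hG) (h'.const_mul (-1))
  simpa [sub_eq_add_neg] using this

theorem HasMean.sum {ι : Type*} (s : Finset ι) {F : ι → ℝ → ℂ} {c : ι → ℂ}
    (hF : ∀ i, Continuous (F i)) (h : ∀ i, HasMean (F i) (c i)) :
    HasMean (fun t => ∑ i ∈ s, F i t) (∑ i ∈ s, c i) := by
  classical
  induction s using Finset.induction_on with
  | empty => intro a; simp
  | insert i s hi ih =>
    simp only [Finset.sum_insert hi]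
    exact (h i).add (hF i) (continuous_finsetSum _ fun i _ => hF i) ih

theorem HasMean.comp_add {F : ℝ → ℂ} {c : ℂ} (h : HasMean F c) (x : ℝ) :
    HasMean (fun s => F (x + s)) c := by
  intro a
  refine (h (x + a)).congr fun T => ?_
  rw [intervalIntegral.integral_comp_add_left (fun s => F s) x, add_assoc]

/-- A majorant varying with t is needed later: errors are bounded by multiples of a tent function,
whose mean may be much smaller than its supremum. -/
theorem HasMean.norm_le_re {F : ℝ → ℂ} {G : ℝ → ℝ} {c m : ℂ} (hG : Continuous G)
    (h : HasMean F c) (h' : HasMean (fun t => (G t : ℂ)) m) (hFG : ∀ t, ‖F t‖ ≤ G t) :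
    ‖c‖ ≤ m.re := by
  refine le_of_tendsto_of_tendsto (h 0).norm
    ((Complex.continuous_re.tendsto m).comp (h' 0)) ?_
  filter_upwards [eventually_gt_atTop 0] with T hT
  have h1 : (∫ t in (0 : ℝ)..(0 + T), ((G t : ℝ) : ℂ)) = ((∫ t in (0 : ℝ)..(0 + T), G t : ℝ) : ℂ) :=
    intervalIntegral.integral_ofReal
  have h2 : ‖∫ t in (0 : ℝ)..(0 + T), F t‖ ≤ ∫ t in (0 : ℝ)..(0 + T), G t :=
    intervalIntegral.norm_integral_le_of_norm_le (by linarith)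
      (Eventually.of_forall fun t _ => hFG t) (hG.intervalIntegrable _ _)
  have h3 : (1 / (T : ℂ)) * ((∫ t in (0 : ℝ)..(0 + T), G t : ℝ) : ℂ)
      = ((1 / T * ∫ t in (0 : ℝ)..(0 + T), G t : ℝ) : ℂ) := by push_cast; rfl
  simp only [Function.comp, h1, h3, Complex.ofReal_re, norm_mul, norm_div, norm_one,
    Complex.norm_real, Real.norm_eq_abs, abs_of_pos hT]
  gcongr

theorem hasMean_const (k : ℂ) : HasMean (fun _ => k) k := by
  intro a
  refine tendsto_const_nhds.congr' ?_
  filter_upwards [eventually_gt_atTop 0] with T hT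
  have : (T : ℂ) ≠ 0 := by exact_mod_cast hT.ne'
  simp
  field_simp

theorem HasMean.norm_le {F : ℝ → ℂ} {c : ℂ} {B : ℝ} (h : HasMean F c) (hF : ∀ t, ‖F t‖ ≤ B) :
    ‖c‖ ≤ B := by
  simpa using h.norm_le_re continuous_const (hasMean_const (B : ℂ)) hF

theorem hasMean_expChar_of_ne {l : ℝ} (hl : l ≠ 0) : HasMean (expChar l) 0 := by
  intro a
  have hl' : Complex.I * (l : ℂ) ≠ 0 := by simp [hl]
  have hint : ∀ T : ℝ, ∫ t in a..(a + T), expChar l t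
      = (expChar l (a + T) - expChar l a) / (Complex.I * l) := fun T => by
    unfold expChar; exact integral_exp_mul_complex hl'
  simp only [hint]
  have h0 : Tendsto (fun T : ℝ => (2 / |l|) * T⁻¹) atTop (𝓝 0) := by
    simpa using tendsto_inv_atTop_zero.const_mul (2 / |l|)
  refine squeeze_zero_norm' ?_ h0
  filter_upwards [eventually_gt_atTop 0] with T hT
  have : ‖expChar l (a + T) - expChar l a‖ ≤ 2 := by
    refine (norm_sub_le _ _).trans ?_
    simp; norm_num
  simp only [norm_mul, norm_div, norm_one, Complex.norm_I, Complex.norm_real, Real.norm_eq_abs,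
    abs_of_pos hT, one_mul]
  rw [one_div, mul_comm]
  gcongr

/-- Means are 1-Lipschitz for the sup norm, so the means of the approximants form a Cauchy sequence;
its limit is the mean of F from every starting point. -/
theorem exists_hasMean_of_approx {F : ℝ → ℂ} (hF : Continuous F)
    (h : ∀ ε > 0, ∃ p : ℝ → ℂ, Continuous p ∧ (∃ c, HasMean p c) ∧ ∀ t, ‖F t - p t‖ ≤ ε) :
    ∃ c, HasMean F c := by
  have hpos : ∀ n : ℕ, (0 : ℝ) < 1 / ((n : ℝ) + 1) := fun n => by positivity
  choose p hpc hpm hp using fun n : ℕ => h (1 / ((n : ℝ) + 1)) (hpos n)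
  choose c hc using hpm
  have hdist : ∀ n m, dist (c n) (c m) ≤ 1 / ((n : ℝ) + 1) + 1 / ((m : ℝ) + 1) := fun n m => by
    rw [dist_eq_norm]
    refine ((hc n).sub (hpc n) (hpc m) (hc m)).norm_le fun t => ?_
    have : p n t - p m t = (F t - p m t) - (F t - p n t) := by ring
    rw [this, add_comm]
    exact (norm_sub_le _ _).trans (add_le_add (hp m t) (hp n t))
  have hcau : CauchySeq c := by
    refine cauchySeq_of_le_tendsto_0 (fun n : ℕ => 2 * (1 / ((n : ℝ) + 1))) (fun n m N hn hm => ?_) ?_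
    · refine (hdist n m).trans ?_
      have h1 := Nat.one_div_le_one_div (α := ℝ) hn
      have h2 := Nat.one_div_le_one_div (α := ℝ) hm
      linarith
    · simpa using (tendsto_one_div_add_atTop_nhds_zero_nat (𝕜 := ℝ)).const_mul 2
  obtain ⟨d, hd⟩ := cauchySeq_tendsto_of_complete hcau
  refine ⟨d, fun a => ?_⟩
  rw [Metric.tendsto_nhds]
  intro ε hε
  obtain ⟨n, hn1, hn2⟩ : ∃ n : ℕ, dist (c n) d < ε / 3 ∧ 1 / ((n : ℝ) + 1) < ε / 3 := by
    have h1 := (Metric.tendsto_nhds.1 hd) (ε / 3) (by positivity)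
    have h2 := (tendsto_one_div_add_atTop_nhds_zero_nat (𝕜 := ℝ)).eventually_lt_const
      (show (0 : ℝ) < ε / 3 by positivity)
    exact (h1.and h2).exists
  filter_upwards [(Metric.tendsto_nhds.1 (hc n a)) (ε / 3) (by positivity),
    eventually_gt_atTop 0] with T hT hT0
  have key : dist ((1 / (T : ℂ)) * ∫ t in a..(a + T), F t)
      ((1 / (T : ℂ)) * ∫ t in a..(a + T), p n t) ≤ 1 / ((n : ℝ) + 1) := by
    rw [dist_eq_norm, ← mul_sub, ← intervalIntegral.integral_sub (hF.intervalIntegrable _ _)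
      ((hpc n).intervalIntegrable _ _), norm_mul]
    have := intervalIntegral.norm_integral_le_of_norm_le_const (a := a) (b := a + T)
      (f := fun t => F t - p n t) (C := 1 / ((n : ℝ) + 1)) fun t _ => hp n t
    simp only [norm_div, norm_one, Complex.norm_real, Real.norm_eq_abs, abs_of_pos hT0]
    rw [add_sub_cancel_left, abs_of_pos hT0] at this
    calc 1 / T * ‖∫ t in a..(a + T), (F t - p n t)‖ ≤ 1 / T * (1 / ((n : ℝ) + 1) * T) := by gcongr
      _ = 1 / ((n : ℝ) + 1) := by field_simp
  calc _ ≤ _ := dist_triangle4 _ ((1 / (T : ℂ)) * ∫ t in a..(a + T), p n t) (c n) d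
    _ < ε := by linarith

/-! ### Trigonometric polynomials and their uniform limits -/

/-- Trigonometric polynomials with frequencies in `M`. -/
noncomputable def trigSpan (M : AddSubgroup ℝ) : Submodule ℂ (ℝ → ℂ) :=
  Submodule.span ℂ (expChar '' M)

/-- `F` is a uniform limit of trigonometric polynomials with frequencies in `M`. -/
def TrigApprox (M : AddSubgroup ℝ) (F : ℝ → ℂ) : Prop :=
  ∀ ε > 0, ∃ p ∈ trigSpan M, ∀ t, ‖F t - p t‖ ≤ ε

variable {M : AddSubgroup ℝ}

theorem expChar_mem_trigSpan {l : ℝ} (hl : l ∈ M) : expChar l ∈ trigSpan M :=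
  Submodule.subset_span ⟨l, hl, rfl⟩

theorem trigSpan_mono {N : AddSubgroup ℝ} (h : M ≤ N) : trigSpan M ≤ trigSpan N :=
  Submodule.span_mono (Set.image_mono h)

theorem continuous_of_mem_trigSpan {p : ℝ → ℂ} (hp : p ∈ trigSpan M) : Continuous p := by
  refine Submodule.span_induction ?_ continuous_const (fun _ _ _ _ hx hy => hx.add hy)
    (fun a _ _ hx => hx.const_smul a) hp
  rintro _ ⟨l, -, rfl⟩
  exact continuous_expChar l

theorem exists_norm_le_of_mem_trigSpan {p : ℝ → ℂ} (hp : p ∈ trigSpan M) :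
    ∃ B, ∀ t, ‖p t‖ ≤ B := by
  refine Submodule.span_induction ?_ ⟨0, by simp⟩ ?_ ?_ hp
  · rintro _ ⟨l, -, rfl⟩
    exact ⟨1, by simp⟩
  · rintro x y - - ⟨A, hA⟩ ⟨B, hB⟩
    exact ⟨A + B, fun t => (norm_add_le _ _).trans (add_le_add (hA t) (hB t))⟩
  · rintro a x - ⟨A, hA⟩
    refine ⟨‖a‖ * A, fun t => ?_⟩
    simpa using mul_le_mul_of_nonneg_left (hA t) (norm_nonneg a)

theorem mul_mem_trigSpan {p q : ℝ → ℂ} (hp : p ∈ trigSpan M) (hq : q ∈ trigSpan M) :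
    p * q ∈ trigSpan M := by
  refine Submodule.span_induction₂ (p := fun x y _ _ => x * y ∈ trigSpan M)
    ?_ ?_ ?_ ?_ ?_ ?_ ?_ hp hq
  · rintro _ _ ⟨l, hl, rfl⟩ ⟨m, hm, rfl⟩
    have : expChar l * expChar m = expChar (l + m) := by
      ext t; simp [expChar_add_left]
    rw [this]
    exact expChar_mem_trigSpan (add_mem hl hm)
  · intro y _; simp
  · intro x _; simp
  · intro x y z _ _ _ h1 h2; rw [add_mul]; exact add_mem h1 h2
  · intro x y z _ _ _ h1 h2; rw [mul_add]; exact add_mem h1 h2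
  · intro r x y _ _ h; rw [smul_mul_assoc]; exact Submodule.smul_mem _ _ h
  · intro r x y _ _ h; rw [mul_smul_comm]; exact Submodule.smul_mem _ _ h

theorem star_mem_trigSpan {p : ℝ → ℂ} (hp : p ∈ trigSpan M) : star p ∈ trigSpan M := by
  refine Submodule.span_induction ?_ ?_ ?_ ?_ hp
  · rintro _ ⟨l, hl, rfl⟩
    have : star (expChar l) = expChar (-l) := by
      ext t; exact star_expChar l t
    rw [this]
    exact expChar_mem_trigSpan (neg_mem hl)
  · simp
  · intro x y _ _ h1 h2; rw [star_add]; exact add_mem h1 h2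
  · intro a x _ h; rw [star_smul]; exact Submodule.smul_mem _ _ h

theorem comp_add_mem_trigSpan {p : ℝ → ℂ} (hp : p ∈ trigSpan M) (a : ℝ) :
    (fun t => p (a + t)) ∈ trigSpan M := by
  refine Submodule.span_induction ?_ ?_ ?_ ?_ hp
  · rintro _ ⟨l, hl, rfl⟩
    have : (fun t => expChar l (a + t)) = expChar l a • expChar l := by
      ext t; simp [expChar_add_right]
    rw [this]
    exact Submodule.smul_mem _ _ (expChar_mem_trigSpan hl)
  · exact zero_mem _
  · intro x y _ _ h1 h2; exact add_mem h1 h2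
  · intro c x _ h; exact Submodule.smul_mem _ c h

theorem TrigApprox.of_mem {p : ℝ → ℂ} (hp : p ∈ trigSpan M) : TrigApprox M p :=
  fun ε hε => ⟨p, hp, fun t => by simpa using hε.le⟩

theorem TrigApprox.mono {N : AddSubgroup ℝ} {F : ℝ → ℂ} (hF : TrigApprox M F) (h : M ≤ N) :
    TrigApprox N F := fun ε hε =>
  let ⟨p, hp, h'⟩ := hF ε hε
  ⟨p, trigSpan_mono h hp, h'⟩

theorem trigApprox_const (c : ℂ) : TrigApprox M fun _ => c := by
  have : (fun _ => c) = c • expChar 0 := by ext t; simp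
  rw [this]
  exact .of_mem (Submodule.smul_mem _ _ (expChar_mem_trigSpan (zero_mem M)))

theorem TrigApprox.of_approx {F : ℝ → ℂ}
    (h : ∀ ε > 0, ∃ G, TrigApprox M G ∧ ∀ t, ‖F t - G t‖ ≤ ε) : TrigApprox M F := by
  intro ε hε
  obtain ⟨G, hG, hFG⟩ := h (ε / 2) (by positivity)
  obtain ⟨p, hp, hGp⟩ := hG (ε / 2) (by positivity)
  refine ⟨p, hp, fun t => ?_⟩
  calc ‖F t - p t‖ = ‖(F t - G t) + (G t - p t)‖ := by ring_nf
    _ ≤ ε / 2 + ε / 2 := (norm_add_le _ _).trans (add_le_add (hFG t) (hGp t))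
    _ = ε := by ring

theorem TrigApprox.add {F G : ℝ → ℂ} (hF : TrigApprox M F) (hG : TrigApprox M G) :
    TrigApprox M (F + G) := by
  intro ε hε
  obtain ⟨p, hp, h1⟩ := hF (ε / 2) (by positivity)
  obtain ⟨q, hq, h2⟩ := hG (ε / 2) (by positivity)
  refine ⟨p + q, add_mem hp hq, fun t => ?_⟩
  calc ‖(F + G) t - (p + q) t‖ = ‖(F t - p t) + (G t - q t)‖ := by
        simp only [Pi.add_apply]; ring_nf
    _ ≤ ε / 2 + ε / 2 := (norm_add_le _ _).trans (add_le_add (h1 t) (h2 t))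
    _ = ε := by ring

theorem TrigApprox.star {F : ℝ → ℂ} (hF : TrigApprox M F) : TrigApprox M (star F) := by
  intro ε hε
  obtain ⟨p, hp, h1⟩ := hF ε hε
  refine ⟨_, star_mem_trigSpan hp, fun t => ?_⟩
  rw [Pi.star_apply, Pi.star_apply, ← star_sub, norm_star]
  exact h1 t

theorem TrigApprox.comp_add {F : ℝ → ℂ} (hF : TrigApprox M F) (a : ℝ) :
    TrigApprox M fun t => F (a + t) := by
  intro ε hε
  obtain ⟨p, hp, h1⟩ := hF ε hε
  exact ⟨_, comp_add_mem_trigSpan hp a, fun t => h1 _⟩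

theorem TrigApprox.exists_norm_le {F : ℝ → ℂ} (hF : TrigApprox M F) : ∃ B, ∀ t, ‖F t‖ ≤ B := by
  obtain ⟨p, hp, h1⟩ := hF 1 one_pos
  obtain ⟨B, hB⟩ := exists_norm_le_of_mem_trigSpan hp
  refine ⟨1 + B, fun t => ?_⟩
  calc ‖F t‖ = ‖(F t - p t) + p t‖ := by ring_nf
    _ ≤ 1 + B := (norm_add_le _ _).trans (add_le_add (h1 t) (hB t))

theorem TrigApprox.mul_of_mem {F p : ℝ → ℂ} (hF : TrigApprox M F) (hp : p ∈ trigSpan M) :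
    TrigApprox M (F * p) := by
  obtain ⟨B, hB⟩ := exists_norm_le_of_mem_trigSpan hp
  have hB0 : 0 ≤ B := (norm_nonneg _).trans (hB 0)
  intro ε hε
  obtain ⟨q, hq, h1⟩ := hF (ε / (B + 1)) (by positivity)
  refine ⟨q * p, mul_mem_trigSpan hq hp, fun t => ?_⟩
  rw [Pi.mul_apply, Pi.mul_apply, ← sub_mul, norm_mul]
  calc ‖F t - q t‖ * ‖p t‖ ≤ ε / (B + 1) * (B + 1) := by
        gcongr
        · exact h1 t
        · linarith [hB t]
    _ = ε := by field_simp

theorem TrigApprox.mul {F G : ℝ → ℂ} (hF : TrigApprox M F) (hG : TrigApprox M G) :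
    TrigApprox M (F * G) := by
  obtain ⟨B, hB⟩ := hF.exists_norm_le
  have hB0 : 0 ≤ B := (norm_nonneg _).trans (hB 0)
  refine .of_approx fun ε hε => ?_
  obtain ⟨q, hq, h1⟩ := hG (ε / (B + 1)) (by positivity)
  refine ⟨F * q, hF.mul_of_mem hq, fun t => ?_⟩
  rw [Pi.mul_apply, Pi.mul_apply, ← mul_sub, norm_mul]
  calc ‖F t‖ * ‖G t - q t‖ ≤ (B + 1) * (ε / (B + 1)) := by
        gcongr
        · linarith [hB t]
        · exact h1 t
    _ = ε := by field_simp

theorem exists_hasMean_of_mem_trigSpan {p : ℝ → ℂ} (hp : p ∈ trigSpan M) : ∃ c, HasMean p c := by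
  induction hp using Submodule.span_induction with
  | mem x hx =>
    obtain ⟨l, -, rfl⟩ := hx
    by_cases hl : l = 0
    · subst hl
      have : expChar 0 = fun _ => 1 := by ext t; simp
      exact ⟨1, this ▸ hasMean_const 1⟩
    · exact ⟨0, hasMean_expChar_of_ne hl⟩
  | zero => exact ⟨0, hasMean_const 0⟩
  | add x y hx hy h1 h2 =>
    obtain ⟨c, hc⟩ := h1
    obtain ⟨d, hd⟩ := h2
    exact ⟨c + d, hc.add (continuous_of_mem_trigSpan hx) (continuous_of_mem_trigSpan hy) hd⟩
  | smul a x hx h =>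
    obtain ⟨c, hc⟩ := h
    exact ⟨a * c, hc.const_mul a⟩

theorem TrigApprox.exists_hasMean {F : ℝ → ℂ} (hF : TrigApprox M F) (hc : Continuous F) :
    ∃ c, HasMean F c := by
  refine exists_hasMean_of_approx hc fun ε hε => ?_
  obtain ⟨p, hp, h⟩ := hF ε hε
  exact ⟨p, continuous_of_mem_trigSpan hp, exists_hasMean_of_mem_trigSpan hp, h⟩

theorem hasMean_mul_expChar_neg_of_mem_trigSpan {p : ℝ → ℂ} (hp : p ∈ trigSpan M) {l : ℝ}
    (hl : l ∉ M) : HasMean (fun t => p t * expChar (-l) t) 0 := by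
  induction hp using Submodule.span_induction with
  | mem x hx =>
    obtain ⟨m, hm, rfl⟩ := hx
    simp only [← expChar_add_left]
    refine hasMean_expChar_of_ne fun h => hl ?_
    have : l = m := by linarith
    exact this ▸ hm
  | zero => simpa using hasMean_const 0
  | add x y hx hy h1 h2 =>
    have := h1.add ((continuous_of_mem_trigSpan hx).mul (continuous_expChar _))
      ((continuous_of_mem_trigSpan hy).mul (continuous_expChar _)) h2
    simpa [add_mul] using this
  | smul a x hx h =>
    have := h.const_mul a
    simpa [mul_assoc] using this

/-- A polynomial with frequencies in M has zero coefficient at any l outside M, and coefficients are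
continuous under uniform limits. -/
theorem TrigApprox.exponentSet_subset {F : ℝ → ℂ} (hF : TrigApprox M F) (hc : Continuous F) :
    exponentSet F ⊆ M := by
  intro l hl
  by_contra hlM
  obtain ⟨c, hc0, hm⟩ := mem_exponentSet_iff.1 hl
  refine hc0 (norm_le_zero_iff.1 (le_of_forall_pos_le_add fun ε hε => ?_))
  obtain ⟨p, hp, h⟩ := hF ε hε
  have h1 := hm.sub (hc.mul (continuous_expChar _))
    ((continuous_of_mem_trigSpan hp).mul (continuous_expChar _))
    (hasMean_mul_expChar_neg_of_mem_trigSpan hp hlM)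
  rw [sub_zero] at h1
  rw [zero_add]
  refine h1.norm_le fun t => ?_
  rw [Pi.mul_apply, Pi.mul_apply, ← sub_mul, norm_mul, norm_expChar, mul_one]
  exact h t

/-! ### Characters of compact abelian groups -/

section CompactOperator

variable {X H : Type*} [TopologicalSpace X] [CompactSpace X] [NormedAddCommGroup H]
  [InnerProductSpace ℂ H]

open scoped BoundedContinuousFunction

/-- The operator sending a vector `u` to the function `x ↦ ⟪A x, u⟫`. -/
noncomputable def innerOperator (A : C(X, H)) : H →L[ℂ] (X →ᵇ ℂ) :=
  LinearMap.mkContinuous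
    { toFun := fun u => BoundedContinuousFunction.mkOfCompact
        ⟨fun x => inner ℂ (A x) u, A.continuous.inner continuous_const⟩
      map_add' := fun u v => by ext x; simp
      map_smul' := fun c u => by ext x; simp }
    ‖A‖ fun u => by
      refine (BoundedContinuousFunction.norm_le (by positivity)).2 fun x => ?_
      exact (norm_inner_le_norm _ _).trans (by gcongr; exact A.norm_coe_le_norm x)

theorem innerOperator_apply (A : C(X, H)) (u : H) (x : X) :
    innerOperator A u x = inner ℂ (A x) u := rfl

/-- Arzelà–Ascoli: by Cauchy–Schwarz, the image of the unit ball inherits the bound and the modulus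
of continuity of A. -/
theorem isCompactOperator_innerOperator (A : C(X, H)) : IsCompactOperator (innerOperator A) := by
  have := (isCompactOperator_iff_isCompact_closure_image_closedBall
    (innerOperator A).toLinearMap one_pos).2 ?_
  · exact this
  refine BoundedContinuousFunction.arzela_ascoli (Metric.closedBall 0 ‖A‖)
    (isCompact_closedBall _ _) _ ?_ ?_
  · rintro _ x ⟨u, hu, rfl⟩
    rw [mem_closedBall_zero_iff] at hu ⊢
    exact (norm_inner_le_norm _ _).trans
      ((mul_le_mul (A.norm_coe_le_norm x) hu (norm_nonneg _) (norm_nonneg _)).trans_eq (mul_one _))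
  · intro x
    rw [Metric.equicontinuousAt_iff_right]
    intro ε hε
    filter_upwards [(Metric.tendsto_nhds.1 (A.continuous.tendsto x)) ε hε]
    rintro y hy ⟨_, u, hu, rfl⟩
    rw [mem_closedBall_zero_iff] at hu
    change dist (inner ℂ (A x) u) (inner ℂ (A y) u) < ε
    rw [dist_eq_norm, ← inner_sub_left]
    rw [dist_comm, dist_eq_norm] at hy
    refine lt_of_le_of_lt ((norm_inner_le_norm _ _).trans ?_) hy
    exact mul_le_of_le_one_right (norm_nonneg _) hu

end CompactOperator

/-- A commuting family of operators preserving a nonzero finite-dimensional subspace has a common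
eigenvector there. -/
theorem exists_common_eigenvector {H ι : Type*} [AddCommGroup H] [Module ℂ H]
    (T : ι → H →ₗ[ℂ] H) (hT : ∀ i j v, T i (T j v) = T j (T i v)) (W : Submodule ℂ H)
    [FiniteDimensional ℂ W] (hW : W ≠ ⊥) (hTW : ∀ i, ∀ v ∈ W, T i v ∈ W) :
    ∃ v ∈ W, v ≠ 0 ∧ ∀ i, ∃ c : ℂ, T i v = c • v := by
  induction hn : Module.finrank ℂ W using Nat.strong_induction_on generalizing W with
  | _ n ih =>
    -- Either every operator is scalar on W and any nonzero vector works, or some operator has a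
    -- proper nonzero eigenspace in W, which the commuting family preserves and to which induction
    -- applies.
    by_cases hs : ∀ i, ∃ c : ℂ, ∀ v ∈ W, T i v = c • v
    · obtain ⟨v, hv, hv0⟩ := W.ne_bot_iff.1 hW
      exact ⟨v, hv, hv0, fun i => (hs i).imp fun c hc => hc v hv⟩
    · push Not at hs
      obtain ⟨i, hi⟩ := hs
      have : Nontrivial W := W.nontrivial_iff_ne_bot.2 hW
      obtain ⟨c, hc⟩ := Module.End.exists_eigenvalue ((T i).restrict (hTW i))
      obtain ⟨⟨v, hvW⟩, hv⟩ := hc.exists_hasEigenvector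
      have hv1 : T i v = c • v := congrArg Subtype.val hv.apply_eq_smul
      have hv0 : v ≠ 0 := fun h => hv.2 (Subtype.ext h)
      let W' : Submodule ℂ H := W ⊓ LinearMap.ker (T i - c • LinearMap.id)
      have hmem : ∀ x, x ∈ W' ↔ x ∈ W ∧ T i x = c • x := fun x => by
        simp [W', sub_eq_zero]
      have hlt : W' < W := by
        refine lt_of_le_of_ne inf_le_left fun h => ?_
        obtain ⟨x, hx, hx'⟩ := hi c
        exact hx' ((hmem x).1 (h ▸ hx)).2
      have : FiniteDimensional ℂ W' := Submodule.finiteDimensional_of_le hlt.le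
      obtain ⟨x, hx, hx'⟩ := ih _ (hn ▸ Submodule.finrank_lt_finrank_of_lt hlt) W'
        (W'.ne_bot_iff.2 ⟨v, (hmem v).2 ⟨hvW, hv1⟩, hv0⟩)
        (fun j x hx => by
          obtain ⟨h1, h2⟩ := (hmem x).1 hx
          exact (hmem _).2 ⟨hTW j x h1, by rw [hT, h2, map_smul]⟩) rfl
      exact ⟨x, hlt.le hx, hx'⟩

/-! ### Peter–Weyl: translation-invariant compact operators on L² of a compact abelian group -/

section Characters

open MeasureTheory
open scoped BoundedContinuousFunction ENNReal

variable {K : Type*} [NormedAddCommGroup K] [MeasurableSpace K] [BorelSpace K]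
  (μ : Measure K) [μ.IsAddHaarMeasure]

/-- Translation `u ↦ u (· + z)` on `L²`. -/
noncomputable def translationL2 (z : K) : Lp ℂ 2 μ →ₗᵢ[ℂ] Lp ℂ 2 μ :=
  Lp.compMeasurePreservingₗᵢ ℂ (· + z) (measurePreserving_add_right μ z)

theorem translationL2_add (z w : K) (u : Lp ℂ 2 μ) :
    translationL2 μ (z + w) u = translationL2 μ z (translationL2 μ w u) := by
  have := Lp.compMeasurePreserving_comp_apply (p := 2) u (measurePreserving_add_right μ w)
    (measurePreserving_add_right μ z)
  refine Eq.trans ?_ this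
  change Lp.compMeasurePreserving _ _ u = _
  congr 1
  congr 1
  ext x
  simp [add_assoc]

theorem translationL2_comm (z w : K) (u : Lp ℂ 2 μ) :
    translationL2 μ z (translationL2 μ w u) = translationL2 μ w (translationL2 μ z u) := by
  rw [← translationL2_add, add_comm, translationL2_add]

theorem translationL2_zero (u : Lp ℂ 2 μ) : translationL2 μ 0 u = u := by
  have h := translationL2_add μ 0 0 u
  rw [add_zero] at h
  exact ((translationL2 μ 0).injective h).symm

theorem translationL2_neg_apply (z : K) (u : Lp ℂ 2 μ) :
    translationL2 μ (-z) (translationL2 μ z u) = u := by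
  rw [← translationL2_add, neg_add_cancel, translationL2_zero]

theorem inner_translationL2_left (z : K) (u v : Lp ℂ 2 μ) :
    inner ℂ (translationL2 μ z u) v = inner ℂ u (translationL2 μ (-z) v) := by
  rw [← (translationL2 μ (-z)).inner_map_map, translationL2_neg_apply]

variable [CompactSpace K]

theorem translationL2_toLp (z : K) (f : C(K, ℂ)) :
    translationL2 μ z (ContinuousMap.toLp 2 μ ℂ f)
      = ContinuousMap.toLp 2 μ ℂ (f.comp ⟨(· + z), by fun_prop⟩) := by
  rfl

/-- The family of translates of the kernel `κ`, as a continuous map into `L²`. -/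
noncomputable def kernelTranslates (κ : C(K, ℂ)) : C(K, Lp ℂ 2 μ) :=
  ((ContinuousMap.toLp 2 μ ℂ : C(K, ℂ) →L[ℂ] Lp ℂ 2 μ) : C(C(K, ℂ), Lp ℂ 2 μ)).comp
    (ContinuousMap.curry ⟨fun q : K × K => κ (q.2 - q.1), by fun_prop⟩)

theorem translationL2_kernelTranslates (κ : C(K, ℂ)) (x z : K) :
    translationL2 μ (-z) (kernelTranslates μ κ x) = kernelTranslates μ κ (x + z) := by
  change translationL2 μ (-z) (ContinuousMap.toLp 2 μ ℂ _) = ContinuousMap.toLp 2 μ ℂ _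
  rw [translationL2_toLp]
  congr 1
  ext y
  change κ (y + -z - x) = κ (y - (x + z))
  congr 1
  abel

theorem innerOperator_translationL2 (κ : C(K, ℂ)) (z x : K) (u : Lp ℂ 2 μ) :
    innerOperator (kernelTranslates μ κ) (translationL2 μ z u) x
      = innerOperator (kernelTranslates μ κ) u (x + z) := by
  rw [innerOperator_apply, innerOperator_apply, ← translationL2_kernelTranslates,
    inner_translationL2_left, neg_neg]

/-- Correlation with the kernel `κ`, as an operator on `L²`. -/
noncomputable def correlationL2 (κ : C(K, ℂ)) : Lp ℂ 2 μ →L[ℂ] Lp ℂ 2 μ :=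
  (BoundedContinuousFunction.toLp 2 μ ℂ).comp (innerOperator (kernelTranslates μ κ))

theorem correlationL2_translationL2 (κ : C(K, ℂ)) (z : K) (u : Lp ℂ 2 μ) :
    correlationL2 μ κ (translationL2 μ z u) = translationL2 μ z (correlationL2 μ κ u) := by
  change ContinuousMap.toLp 2 μ ℂ (innerOperator (kernelTranslates μ κ)
    (translationL2 μ z u)).toContinuousMap = translationL2 μ z (ContinuousMap.toLp 2 μ ℂ
    (innerOperator (kernelTranslates μ κ) u).toContinuousMap)
  rw [translationL2_toLp]
  congr 1
  ext x
  exact innerOperator_translationL2 μ κ z x u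

theorem isCompactOperator_correlationL2 (κ : C(K, ℂ)) : IsCompactOperator (correlationL2 μ κ) :=
  (isCompactOperator_innerOperator (kernelTranslates μ κ)).clm_comp
    (BoundedContinuousFunction.toLp 2 μ ℂ)

open ContinuousLinearMap in
theorem adjoint_correlationL2_translationL2 (κ : C(K, ℂ)) (z : K) (u : Lp ℂ 2 μ) :
    adjoint (correlationL2 μ κ) (translationL2 μ z u)
      = translationL2 μ z (adjoint (correlationL2 μ κ) u) := by
  refine ext_inner_right ℂ fun v => ?_
  rw [adjoint_inner_left, inner_translationL2_left, inner_translationL2_left,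
    adjoint_inner_left, correlationL2_translationL2]

open ContinuousLinearMap in
-- With S the correlation operator, S*S is compact, self-adjoint and commutes with translations, so
-- its nonzero eigenspaces are finite-dimensional and invariant and contain common eigenvectors of
-- all translations. If k fixed all those not killed by S, then S(U_k - 1) would vanish on every
-- eigenspace of S*S, hence everywhere by the spectral theorem.
theorem exists_eigenvector_translationL2_ne (κ : C(K, ℂ)) (k : K) (u : Lp ℂ 2 μ)
    (hu : correlationL2 μ κ (translationL2 μ k u - u) ≠ 0) :
    ∃ v : Lp ℂ 2 μ, correlationL2 μ κ v ≠ 0 ∧ (∀ z, ∃ c : ℂ, translationL2 μ z v = c • v) ∧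
      translationL2 μ k v ≠ v := by
  set S := correlationL2 μ κ with hS
  set T : Lp ℂ 2 μ →L[ℂ] Lp ℂ 2 μ := (adjoint S).comp S with hTdef
  have hTcomm : ∀ z v, T (translationL2 μ z v) = translationL2 μ z (T v) := fun z v => by
    change adjoint S (S _) = translationL2 μ z (adjoint S (S v))
    rw [hS, correlationL2_translationL2, adjoint_correlationL2_translationL2]
  have hTcpt : IsCompactOperator T := 
    (isCompactOperator_correlationL2 μ κ).clm_comp (adjoint S)
  have hTsymm : T.IsSymmetric := fun x y => by
    change inner ℂ (adjoint S (S x)) y = inner ℂ x (adjoint S (S y))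
    rw [adjoint_inner_left, adjoint_inner_right]
  have hker : ∀ v, T v = 0 → S v = 0 := fun v hv => by
    have : inner ℂ (S v) (S v) = 0 := by
      rw [← adjoint_inner_left]
      change inner ℂ (T v) v = 0
      rw [hv, inner_zero_left]
    exact inner_self_eq_zero.1 this
  let D : Lp ℂ 2 μ →L[ℂ] Lp ℂ 2 μ :=
    (translationL2 μ k).toContinuousLinearMap - ContinuousLinearMap.id ℂ _
  have hD : ∀ v, D v = translationL2 μ k v - v := fun v => rfl
  have hDU : ∀ z v, D (translationL2 μ z v) = translationL2 μ z (D v) := fun z v => by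
    rw [hD, hD, map_sub, translationL2_comm]
  have hDT : ∀ v, D (T v) = T (D v) := fun v => by
    rw [hD, hD, map_sub, hTcomm]
  -- `D` has orthogonal kernel and range
  have hDorth : ∀ v, D (D v) = 0 → D v = 0 := fun v hv => by
    have h1 : translationL2 μ k (D v) = D v := sub_eq_zero.1 hv
    have h2 : inner ℂ (D v) (translationL2 μ k v) = inner ℂ (D v) v := by
      rw [← (translationL2 μ k).inner_map_map (D v) v, h1]
    have : inner ℂ (D v) (D v) = 0 := by
      conv_lhs => rw [hD v, inner_sub_right]
      rw [← hD v, h2, sub_self]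
    exact inner_self_eq_zero.1 this
  by_contra hcon
  push Not at hcon
  have hzero : ∀ r : ℂ, r ≠ 0 → ∀ v, T v = r • v → D v = 0 := by
    intro r hr v hv
    by_contra hDv
    let E := Module.End.eigenspace T.toLinearMap r
    have hE : ∀ x, x ∈ E ↔ T x = r • x := fun x => Module.End.mem_eigenspace_iff
    have : FiniteDimensional ℂ E := finite_dimensional_eigenspace hTcpt r hr
    -- Searching in the image of D rather than in E gives a common eigenvector of the form D x; if k
    -- fixes it, then D (D x) = 0, which forces D x = 0.
    let W : Submodule ℂ (Lp ℂ 2 μ) := E.map D.toLinearMap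
    obtain ⟨w, hw, hw0, hwU⟩ := exists_common_eigenvector
      (fun z => (translationL2 μ z).toLinearMap) (fun i j v => translationL2_comm μ i j v) W
      (W.ne_bot_iff.2 ⟨D v, ⟨v, (hE v).2 hv, rfl⟩, hDv⟩) (by
        rintro z _ ⟨x, hx, rfl⟩
        refine ⟨translationL2 μ z x, (hE _).2 ?_, hDU z x⟩
        rw [hTcomm, (hE x).1 hx, map_smul])
    obtain ⟨x, hx, rfl⟩ := hw
    have hTw : T (D x) = r • D x := by rw [← hDT, (hE x).1 hx, map_smul]
    have hSw : S (D x) ≠ 0 := fun h => by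
      have h' : T (D x) = 0 := by
        change adjoint S (S (D x)) = 0
        rw [h, map_zero]
      rw [hTw] at h'
      exact hw0 ((smul_eq_zero.1 h').resolve_left hr)
    have h3 := hcon (D x) hSw hwU
    exact hw0 (hDorth x (by rw [hD (D x), h3, sub_self]))
  have htop : (⨆ r, Module.End.eigenspace T.toLinearMap r : Submodule ℂ (Lp ℂ 2 μ))
      ≤ LinearMap.ker (S.comp D).toLinearMap := by
    refine iSup_le fun r x hx => ?_
    have hx' : T x = r • x := Module.End.mem_eigenspace_iff.1 hx
    change S (D x) = 0
    by_cases hr : r = 0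
    · have : S x = 0 := hker x (by rw [hx', hr, zero_smul])
      rw [hD, map_sub, hS, correlationL2_translationL2, ← hS, this, map_zero, sub_zero]
    · rw [hzero r hr x hx', map_zero]
  have hdense := orthogonalComplement_iSup_eigenspaces_eq_bot hTcpt hTsymm
  rw [← Submodule.topologicalClosure_eq_top_iff] at hdense
  have hle := Submodule.topologicalClosure_minimal _ htop (S.comp D).isClosed_ker
  exact hu ((hdense ▸ hle) (Submodule.mem_top (x := u)))

/-- The tent function of radius `ε` around the origin. -/
noncomputable def tent (G : Type*) [SeminormedAddCommGroup G] (ε : ℝ) : C(G, ℂ) :=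
  ⟨fun y => ((max 0 (ε - ‖y‖) : ℝ) : ℂ), by fun_prop⟩

theorem tent_apply {G : Type*} [SeminormedAddCommGroup G] (ε : ℝ) (y : G) :
    tent G ε y = ((max 0 (ε - ‖y‖) : ℝ) : ℂ) := rfl

/-- The continuous characters of a compact abelian group separate its points. -/
theorem exists_character_ne_one {k : K} (hk : k ≠ 0) :
    ∃ χ : C(K, ℂ), χ 0 = 1 ∧ (∀ x y, χ (x + y) = χ x * χ y) ∧ (∀ x, ‖χ x‖ = 1) ∧ χ k ≠ 1 := by
  let μ : Measure K := Measure.addHaar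
  have hk' : 0 < ‖k‖ := norm_pos_iff.2 hk
  -- With radius ‖k‖ / 2 the tent and its translate by k have disjoint supports, hence are
  -- orthogonal in L².
  let κ := tent K (‖k‖ / 2)
  let u : Lp ℂ 2 μ := ContinuousMap.toLp 2 μ ℂ κ
  have hu0 : u ≠ 0 := fun h => by
    have h1 : κ = 0 := ContinuousMap.toLp_injective (p := 2) (𝕜 := ℂ) μ
      (h.trans (map_zero _).symm)
    have h2 : κ 0 = 0 := by rw [h1]; rfl
    simp [κ, tent_apply] at h2
    linarith
  have hA0 : kernelTranslates μ κ 0 = u := by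
    change ContinuousMap.toLp 2 μ ℂ _ = ContinuousMap.toLp 2 μ ℂ _
    congr 1
    ext y
    change κ (y - 0) = κ y
    rw [sub_zero]
  have hint : inner ℂ u (translationL2 μ k u) = 0 := by
    rw [translationL2_toLp, ContinuousMap.inner_toLp]
    refine integral_eq_zero_of_ae (Eventually.of_forall fun y => ?_)
    have : ‖k‖ ≤ ‖y + k‖ + ‖y‖ := by
      calc ‖k‖ = ‖(y + k) - y‖ := by abel_nf
        _ ≤ _ := norm_sub_le _ _
    change (κ (y + k)) * (starRingEnd ℂ) (κ y) = 0
    simp only [κ, tent_apply, Complex.conj_ofReal, ← Complex.ofReal_mul, Complex.ofReal_eq_zero]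
    rcases le_total (‖k‖ / 2) ‖y‖ with h | h
    · rw [max_eq_left (by linarith : ‖k‖ / 2 - ‖y‖ ≤ 0), mul_zero]
    · rw [max_eq_left (by linarith : ‖k‖ / 2 - ‖y + k‖ ≤ 0), zero_mul]
  -- The value at 0 of the correlation is ⟪u, U_k u - u⟫ = -‖u‖².
  have hne : correlationL2 μ κ (translationL2 μ k u - u) ≠ 0 := fun h => by
    have h1 : innerOperator (kernelTranslates μ κ) (translationL2 μ k u - u) = 0 :=
      BoundedContinuousFunction.toLp_injective (p := 2) (𝕜 := ℂ) μ
        (h.trans (map_zero _).symm)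
    have h2 := DFunLike.congr_fun h1 0
    rw [innerOperator_apply, hA0, inner_sub_right, hint, zero_sub] at h2
    exact hu0 (inner_self_eq_zero.1 (neg_eq_zero.1 h2))
  obtain ⟨v, hv, hU, hvk⟩ := exists_eigenvector_translationL2_ne μ κ k u hne
  have hv0 : v ≠ 0 := fun h => hv (by rw [h, map_zero])
  choose c hc using hU
  -- The eigenvector v is only an L² class; its correlation w is a continuous function with the same
  -- eigenvalues, and the normalized w is the character.
  set w := innerOperator (kernelTranslates μ κ) v with hw
  have hwc : ∀ x z, w (x + z) = c z * w x := fun x z => by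
    rw [hw, ← innerOperator_translationL2, hc, map_smul]; rfl
  obtain ⟨x₀, hx₀⟩ : ∃ x, w x ≠ 0 := by
    by_contra! h
    refine hv ?_
    have : w = 0 := by ext x; exact h x
    change BoundedContinuousFunction.toLp 2 μ ℂ w = 0
    rw [this, map_zero]
  have hχ : ∀ z, w (x₀ + z) / w x₀ = c z := fun z => by rw [hwc]; field_simp
  refine ⟨⟨fun z => w (x₀ + z) / w x₀, by fun_prop⟩, ?_, ?_, ?_, ?_⟩
  · simp [hx₀]
  · intro x y
    change w (x₀ + (x + y)) / w x₀ = (w (x₀ + x) / w x₀) * (w (x₀ + y) / w x₀)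
    rw [hχ y, ← add_assoc, hwc]; ring
  · intro x
    change ‖w (x₀ + x) / w x₀‖ = 1
    rw [hχ]
    have h1 : ‖c x‖ * ‖v‖ = ‖v‖ := by rw [← norm_smul, ← hc, LinearIsometry.norm_map]
    exact mul_right_cancel₀ (norm_ne_zero_iff.2 hv0) (h1.trans (one_mul _).symm)
  · change w (x₀ + k) / w x₀ ≠ 1
    rw [hχ]
    intro h
    exact hvk (by rw [hc, h, one_smul])

end Characters

/-! ### Continuous characters of the real line -/

/-- The continuous unitary characters of the real line are the functions `expChar l`. -/
theorem exists_eq_expChar {χ : ℝ → ℂ} (hc : Continuous χ) (h0 : χ 0 = 1)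
    (hadd : ∀ s t, χ (s + t) = χ s * χ t) (hn : ∀ t, ‖χ t‖ = 1) : ∃ l, χ = expChar l := by
  have hderiv : ∀ b, HasDerivAt (fun t => ∫ s in (0 : ℝ)..t, χ s) (χ b) b := fun b =>
    intervalIntegral.integral_hasDerivAt_right (hc.intervalIntegrable _ _)
      (hc.stronglyMeasurableAtFilter _ _) hc.continuousAt
  obtain ⟨a, ha⟩ : ∃ a, ∫ s in (0 : ℝ)..a, χ s ≠ 0 := by
    by_contra! h
    have h1 := hderiv 0
    simp only [h] at h1
    have := h1.unique (hasDerivAt_const (0 : ℝ) (0 : ℂ))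
    rw [h0] at this
    exact one_ne_zero this
  set I := ∫ s in (0 : ℝ)..a, χ s with hI
  -- Integrating χ(t + s) = χ(t) χ(s) over s from 0 to a writes χ through its primitive, so χ is
  -- differentiable and satisfies χ' = c χ.
  have hχ : ∀ t, χ t = ((∫ s in (0 : ℝ)..(t + a), χ s) - ∫ s in (0 : ℝ)..t, χ s) / I := fun t => by
    rw [intervalIntegral.integral_interval_sub_left (hc.intervalIntegrable _ _)
      (hc.intervalIntegrable _ _), eq_div_iff ha, hI, ← intervalIntegral.integral_const_mul]
    simp only [← hadd]
    rw [intervalIntegral.integral_comp_add_left (fun s => χ s) t, add_zero]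
  set c := (χ a - 1) / I with hcdef
  have hd : ∀ t, HasDerivAt χ (c * χ t) t := fun t => by
    have h1 := ((hderiv (t + a)).comp_add_const t a).sub (hderiv t) |>.div_const I
    have h2 : (χ (t + a) - χ t) / I = c * χ t := by rw [hadd, hcdef]; ring
    rw [h2] at h1
    exact h1.congr_of_eventuallyEq (Eventually.of_forall hχ)
  have hexp : ∀ t : ℝ, HasDerivAt (fun t : ℝ => Complex.exp (-c * t)) (Complex.exp (-c * t) * -c) t :=
    fun t => by
      have h1 : HasDerivAt (fun t : ℝ => -c * (t : ℂ)) (-c) t := by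
        simpa using (Complex.ofRealCLM.hasDerivAt (x := t)).const_mul (-c)
      exact h1.cexp
  have hg : ∀ t, HasDerivAt (fun t : ℝ => χ t * Complex.exp (-c * t)) 0 t := fun t => by
    have := (hd t).mul (hexp t)
    exact this.congr_deriv (by ring)
  have hconst : ∀ t : ℝ, χ t * Complex.exp (-c * t) = 1 := fun t => by
    have := is_const_of_deriv_eq_zero (fun t => (hg t).differentiableAt) (fun t => (hg t).deriv) t 0
    simpa [h0] using this
  have hχe : ∀ t : ℝ, χ t = Complex.exp (c * t) := fun t => by
    have h1 := hconst t
    rw [neg_mul, Complex.exp_neg] at h1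
    exact (mul_inv_eq_one₀ (Complex.exp_ne_zero _)).1 h1
  have hre : c.re = 0 := by
    have h1 := hn 1
    rw [hχe, Complex.norm_exp] at h1
    simpa using h1
  refine ⟨c.im, funext fun t => ?_⟩
  rw [hχe, expChar]
  congr 2
  conv_lhs => rw [← Complex.re_add_im c, hre]
  simp [mul_comm]

/-! ### Precompact seminorms on the real line -/

/-- A continuous seminorm on the group `ℝ` admitting finite nets of every radius. -/
structure PrecompactSeminorm (p : AddGroupSeminorm ℝ) : Prop where
  continuous : Continuous p
  exists_net : ∀ ε > 0, ∃ s : Finset ℝ, ∀ x, ∃ y ∈ s, p (x - y) < ε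

/-- Without a finite ε-net one picks inductively a sequence with mutual distances at least ε, which
has no Cauchy subsequence. -/
theorem exists_net_of_exists_cauchy_subseq {p : AddGroupSeminorm ℝ}
    (h : ∀ s : ℕ → ℝ, ∃ φ : ℕ → ℕ, StrictMono φ ∧
      ∀ ε > 0, ∃ N, ∀ m ≥ N, ∀ n ≥ N, p (s (φ m) - s (φ n)) ≤ ε) {ε : ℝ} (hε : 0 < ε) :
    ∃ s : Finset ℝ, ∀ x, ∃ y ∈ s, p (x - y) < ε := by
  by_contra! hcon
  obtain ⟨u, hu⟩ := Set.seq_of_forall_finite_exists (P := fun x (t : Set ℝ) => ∀ y ∈ t, ε ≤ p (x - y))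
    fun t ht => by simpa using hcon ht.toFinset
  obtain ⟨φ, hφ, hN⟩ := h u
  obtain ⟨N, hN⟩ := hN (ε / 2) (by positivity)
  have h1 := hN (N + 1) (by omega) N le_rfl
  have h2 := hu (φ (N + 1)) (u (φ N)) ⟨φ N, hφ (Nat.lt_succ_self N), rfl⟩
  linarith

/-! ### The compact group completing the line -/

/-- The real line with the topology of the seminorm `p`. -/
def SeminormedLine (_p : AddGroupSeminorm ℝ) : Type := ℝ

noncomputable instance (p : AddGroupSeminorm ℝ) : SeminormedAddCommGroup (SeminormedLine p) :=
  AddGroupSeminorm.toSeminormedAddCommGroup (E := ℝ) p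

/-- The Hausdorff completion of the real line with respect to the seminorm `p`. -/
abbrev LineCompletion (p : AddGroupSeminorm ℝ) : Type := UniformSpace.Completion (SeminormedLine p)

/-- The canonical homomorphism from the real line to its completion. -/
noncomputable def toLineCompletion (p : AddGroupSeminorm ℝ) (t : ℝ) : LineCompletion p :=
  ((show SeminormedLine p from t : SeminormedLine p) : LineCompletion p)

section LineCompletion

variable {p : AddGroupSeminorm ℝ}

theorem toLineCompletion_zero : toLineCompletion p 0 = 0 :=
  UniformSpace.Completion.coe_zero

theorem toLineCompletion_add (s t : ℝ) :
    toLineCompletion p (s + t) = toLineCompletion p s + toLineCompletion p t :=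
  UniformSpace.Completion.coe_add _ _

theorem toLineCompletion_sub (s t : ℝ) :
    toLineCompletion p (s - t) = toLineCompletion p s - toLineCompletion p t :=
  UniformSpace.Completion.coe_sub _ _

theorem norm_toLineCompletion (t : ℝ) : ‖toLineCompletion p t‖ = p t :=
  UniformSpace.Completion.norm_coe (show SeminormedLine p from t)

theorem denseRange_toLineCompletion : DenseRange (toLineCompletion p) :=
  UniformSpace.Completion.denseRange_coe (α := SeminormedLine p)

theorem dist_toLineCompletion (s t : ℝ) :
    dist (toLineCompletion p s) (toLineCompletion p t) = p (s - t) := by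
  rw [dist_eq_norm, ← toLineCompletion_sub, norm_toLineCompletion]

theorem continuous_toLineCompletion (hp : Continuous p) : Continuous (toLineCompletion p) := by
  refine continuous_iff_continuousAt.2 fun a => tendsto_iff_dist_tendsto_zero.2 ?_
  simp only [dist_toLineCompletion]
  have : Continuous fun t => p (t - a) := hp.comp (by fun_prop)
  simpa using this.tendsto a

theorem PrecompactSeminorm.compactSpace (hp : PrecompactSeminorm p) :
    CompactSpace (LineCompletion p) := by
  refine ⟨TotallyBounded.isCompact_of_isClosed ?_ isClosed_univ⟩
  rw [← denseRange_toLineCompletion.closure_range]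
  refine TotallyBounded.closure (Metric.totallyBounded_iff.2 fun ε hε => ?_)
  obtain ⟨s, hs⟩ := hp.exists_net ε hε
  refine ⟨toLineCompletion p '' s, s.finite_toSet.image _, ?_⟩
  rintro _ ⟨x, rfl⟩
  obtain ⟨y, hy, hxy⟩ := hs x
  simp only [Set.mem_iUnion]
  exact ⟨_, ⟨y, hy, rfl⟩, by rwa [Metric.mem_ball, dist_toLineCompletion]⟩

/-- A function that is uniformly continuous for `p` extends to the completion. -/
theorem exists_continuousMap_toLineCompletion {h : ℝ → ℂ}
    (hh : ∀ ε > 0, ∃ δ > 0, ∀ s t, p (s - t) < δ → ‖h s - h t‖ < ε) :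
    ∃ F : C(LineCompletion p, ℂ), ∀ t, F (toLineCompletion p t) = h t := by
  have huc : UniformContinuous (show SeminormedLine p → ℂ from h) := by
    refine Metric.uniformContinuous_iff.2 fun ε hε => ?_
    obtain ⟨δ, hδ, H⟩ := hh ε hε
    refine ⟨δ, hδ, fun {s t} hst => ?_⟩
    rw [dist_eq_norm] at hst ⊢
    exact H s t hst
  exact ⟨⟨_, UniformSpace.Completion.continuous_extension (f := (show SeminormedLine p → ℂ from h))⟩,
    fun t => UniformSpace.Completion.extension_coe huc _⟩

/-- If the continuous functions on the completion that restrict to limits of trigonometric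
polynomials with frequencies in `M` separate points, then all continuous functions do so. -/
theorem trigApprox_comp_toLineCompletion [CompactSpace (LineCompletion p)] {M : AddSubgroup ℝ}
    (hsep : ∀ x y : LineCompletion p, x ≠ y → ∃ G : C(LineCompletion p, ℂ),
      TrigApprox M (fun t => G (toLineCompletion p t)) ∧ G x ≠ G y)
    (F : C(LineCompletion p, ℂ)) : TrigApprox M fun t => F (toLineCompletion p t) := by
  let A : StarSubalgebra ℂ C(LineCompletion p, ℂ) :=
    { carrier := {G | TrigApprox M fun t => G (toLineCompletion p t)}
      mul_mem' := fun hF hG => hF.mul hG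
      add_mem' := fun hF hG => hF.add hG
      algebraMap_mem' := fun c => trigApprox_const c
      star_mem' := fun hF => hF.star }
  have htop : A.topologicalClosure = ⊤ :=
    ContinuousMap.starSubalgebra_topologicalClosure_eq_top_of_separatesPoints A fun x y hxy => by
      obtain ⟨G, hG, hne⟩ := hsep x y hxy
      exact ⟨G, ⟨G, hG, rfl⟩, hne⟩
  have hF : F ∈ closure (A : Set C(LineCompletion p, ℂ)) := by
    have : F ∈ A.topologicalClosure := htop ▸ StarSubalgebra.mem_top
    exact this
  refine .of_approx fun ε hε => ?_
  obtain ⟨G, hG, hFG⟩ := Metric.mem_closure_iff.1 hF ε hε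
  refine ⟨_, hG, fun t => ?_⟩
  rw [dist_eq_norm] at hFG
  exact ((F - G).norm_coe_le_norm _).trans hFG.le

/-- Stone–Weierstrass on the completion, where points are separated by characters; each restricts to
some `expChar l`. -/
theorem PrecompactSeminorm.trigApprox_top (hp : PrecompactSeminorm p) {h : ℝ → ℂ}
    (hh : ∀ ε > 0, ∃ δ > 0, ∀ s t, p (s - t) < δ → ‖h s - h t‖ < ε) : TrigApprox ⊤ h := by
  have := hp.compactSpace
  obtain ⟨F, hF⟩ := exists_continuousMap_toLineCompletion hh
  rw [← funext hF]
  refine trigApprox_comp_toLineCompletion (fun x y hxy => ?_) F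
  let _ : MeasurableSpace (LineCompletion p) := borel _
  have : BorelSpace (LineCompletion p) := ⟨rfl⟩
  obtain ⟨χ, h0, hadd, hn, hne⟩ := exists_character_ne_one (sub_ne_zero.2 hxy)
  refine ⟨χ, ?_, fun h => hne ?_⟩
  · obtain ⟨l, hl⟩ := exists_eq_expChar (χ := fun t => χ (toLineCompletion p t))
      (χ.continuous.comp (continuous_toLineCompletion hp.continuous))
      (by simp [toLineCompletion_zero, h0]) (fun s t => by rw [toLineCompletion_add, hadd])
      (fun t => hn _)
    rw [hl]
    exact .of_mem (expChar_mem_trigSpan trivial)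
  · have h1 : χ (x - y) * χ y = χ y := by rw [← hadd, sub_add_cancel, h]
    have h2 : χ y ≠ 0 := fun h' => by simpa [h'] using hn y
    exact mul_right_cancel₀ h2 (h1.trans (one_mul _).symm)

end LineCompletion

/-! ### The translation seminorm of an almost periodic function -/

theorem translatesConverge_iff {f : ℝ → ℂ} {s : ℕ → ℝ} :
    TranslatesConverge f s ↔
      ∀ ε > 0, ∃ N, ∀ m ≥ N, ∀ n ≥ N, ∀ t, ‖f (t + s m) - f (t + s n)‖ ≤ ε := by
  constructor
  · rintro ⟨F, hF⟩ ε hε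
    obtain ⟨N, hN⟩ := eventually_atTop.1 (Metric.tendstoUniformly_iff.1 hF (ε / 2) (by positivity))
    refine ⟨N, fun m hm n hn t => ?_⟩
    rw [← dist_eq_norm]
    refine (dist_triangle_left _ _ (F t)).trans ?_
    linarith [hN m hm t, hN n hn t]
  · intro h
    have hlim : ∀ t, ∃ z, Tendsto (fun n => f (t + s n)) atTop (𝓝 z) := fun t => by
      refine cauchySeq_tendsto_of_complete (Metric.cauchySeq_iff.2 fun ε hε => ?_)
      obtain ⟨N, hN⟩ := h (ε / 2) (by positivity)
      refine ⟨N, fun m hm n hn => ?_⟩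
      rw [dist_eq_norm]
      linarith [hN m hm n hn t]
    choose F hF using hlim
    refine ⟨F, Metric.tendstoUniformly_iff.2 fun ε hε => ?_⟩
    obtain ⟨N, hN⟩ := h (ε / 2) (by positivity)
    filter_upwards [eventually_ge_atTop N] with n hn t
    have h1 : dist (F t) (f (t + s n)) ≤ ε / 2 := by
      refine le_of_tendsto ((hF t).dist tendsto_const_nhds) ?_
      filter_upwards [eventually_ge_atTop N] with m hm
      rw [dist_eq_norm]
      exact hN m hm n hn t
    linarith

theorem IsAlmostPeriodic.exists_norm_le {f : ℝ → ℂ} (hf : IsAlmostPeriodic f) :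
    ∃ B, ∀ t, ‖f t‖ ≤ B := by
  by_contra! h
  choose s hs using fun n : ℕ => h n
  obtain ⟨φ, hφ, F, hF⟩ := hf.exists_subseq s
  have h1 := ((hF.tendsto_at 0).norm).bddAbove_range
  obtain ⟨B, hB⟩ := h1
  obtain ⟨n, hn⟩ := exists_nat_gt B
  have h2 : ‖f (0 + (s ∘ φ) n)‖ ≤ B := hB ⟨n, rfl⟩
  have h3 := hs (φ n)
  have h4 : (n : ℝ) ≤ φ n := by exact_mod_cast hφ.id_le n
  simp only [Function.comp, zero_add] at h2
  linarith

/-- The seminorm `t ↦ sup_x ‖f (x + t) - f x‖` on the group `ℝ`, for bounded `f`. -/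
noncomputable def translationSeminorm (f : ℝ → ℂ) (hf : ∃ B, ∀ t, ‖f t‖ ≤ B) :
    AddGroupSeminorm ℝ :=
  have hbdd : ∀ t, BddAbove (Set.range fun x => ‖f (x + t) - f x‖) := fun t => by
    obtain ⟨B, hB⟩ := hf
    refine ⟨B + B, ?_⟩
    rintro _ ⟨x, rfl⟩
    exact (norm_sub_le _ _).trans (add_le_add (hB _) (hB _))
  have hneg : ∀ t, ⨆ x, ‖f (x + -t) - f x‖ ≤ ⨆ x, ‖f (x + t) - f x‖ := fun t =>
    ciSup_le fun x => by
      refine le_ciSup_of_le (hbdd t) (x + -t) ?_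
      rw [neg_add_cancel_right, norm_sub_rev]
  { toFun := fun t => ⨆ x, ‖f (x + t) - f x‖
    map_zero' := by simp
    add_le' := fun s t => ciSup_le fun x => by
      calc ‖f (x + (s + t)) - f x‖ = ‖(f (x + s) - f x) + (f (x + s + t) - f (x + s))‖ := by
            rw [add_assoc]; ring_nf
        _ ≤ _ := norm_add_le _ _
        _ ≤ _ := add_le_add (le_ciSup (hbdd s) x) (le_ciSup (hbdd t) (x + s))
    neg' := fun t => le_antisymm (hneg t) (by simpa using hneg (-t)) }

theorem translationSeminorm_le {f : ℝ → ℂ} (hf : ∃ B, ∀ t, ‖f t‖ ≤ B) {t c : ℝ}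
    (h : ∀ x, ‖f (x + t) - f x‖ ≤ c) : translationSeminorm f hf t ≤ c :=
  ciSup_le h

theorem norm_sub_le_translationSeminorm {f : ℝ → ℂ} (hf : ∃ B, ∀ t, ‖f t‖ ≤ B) (x t : ℝ) :
    ‖f (x + t) - f x‖ ≤ translationSeminorm f hf t := by
  refine le_ciSup (f := fun x => ‖f (x + t) - f x‖) ?_ x
  obtain ⟨B, hB⟩ := hf
  refine ⟨B + B, ?_⟩
  rintro _ ⟨x, rfl⟩
  exact (norm_sub_le _ _).trans (add_le_add (hB _) (hB _))

theorem norm_sub_le_translationSeminorm_sub {f : ℝ → ℂ} (hf : ∃ B, ∀ t, ‖f t‖ ≤ B) (x s t : ℝ) :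
    ‖f (x + s) - f (x + t)‖ ≤ translationSeminorm f hf (s - t) := by
  have := norm_sub_le_translationSeminorm hf (x + t) (s - t)
  rwa [show x + t + (s - t) = x + s by ring] at this

theorem TranslatesConverge.translationSeminorm_le {f : ℝ → ℂ} (hf : ∃ B, ∀ t, ‖f t‖ ≤ B)
    {s : ℕ → ℝ} (hs : TranslatesConverge f s) :
    ∀ ε > 0, ∃ N, ∀ m ≥ N, ∀ n ≥ N, translationSeminorm f hf (s m - s n) ≤ ε := by
  intro ε hε
  obtain ⟨N, hN⟩ := translatesConverge_iff.1 hs ε hε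
  refine ⟨N, fun m hm n hn => _root_.translationSeminorm_le hf fun x => ?_⟩
  have := hN m hm n hn (x - s n)
  rwa [sub_add_cancel, show x - s n + s m = x + (s m - s n) by ring] at this

theorem TranslatesConverge.comp {f : ℝ → ℂ} {s : ℕ → ℝ} (hs : TranslatesConverge f s)
    {φ : ℕ → ℕ} (hφ : StrictMono φ) : TranslatesConverge f (s ∘ φ) := by
  obtain ⟨F, hF⟩ := hs
  exact ⟨F, fun u hu => hφ.tendsto_atTop.eventually (hF u hu)⟩

theorem AddGroupSeminorm.continuous_of_tendsto_zero {p : AddGroupSeminorm ℝ}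
    (h : Tendsto p (𝓝 0) (𝓝 0)) : Continuous p := by
  refine continuous_iff_continuousAt.2 fun a => tendsto_iff_dist_tendsto_zero.2 ?_
  have h1 : Tendsto (fun t => p (t - a)) (𝓝 a) (𝓝 0) := by
    refine h.comp ?_
    have : Continuous fun t : ℝ => t - a := by fun_prop
    simpa using this.tendsto a
  refine squeeze_zero (fun _ => dist_nonneg) (fun t => ?_) h1
  rw [Real.dist_eq]
  exact abs_sub_map_le_sub p t a

theorem IsAlmostPeriodic.continuous_translationSeminorm {f : ℝ → ℂ} (hf : IsAlmostPeriodic f) :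
    Continuous (translationSeminorm f hf.exists_norm_le) := by
  refine AddGroupSeminorm.continuous_of_tendsto_zero (tendsto_of_seq_tendsto fun u hu => ?_)
  refine tendsto_of_subseq_tendsto fun ns hns => ?_
  obtain ⟨φ, hφ, F, hF⟩ := hf.exists_subseq (u ∘ ns)
  have hu' : Tendsto ((u ∘ ns) ∘ φ) atTop (𝓝 0) := (hu.comp hns).comp hφ.tendsto_atTop
  -- The shifts tend to 0, so continuity of f identifies the uniform limit as f itself, and the
  -- seminorms of the shifts tend to 0.
  have hFf : F = f := funext fun x => by
    refine tendsto_nhds_unique (hF.tendsto_at x) ?_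
    have h1 : Tendsto (fun n => x + ((u ∘ ns) ∘ φ) n) atTop (𝓝 (x + 0)) := hu'.const_add x
    rw [add_zero] at h1
    exact (hf.continuous.tendsto x).comp h1
  subst hFf
  refine ⟨φ, Metric.tendsto_atTop.2 fun ε hε => ?_⟩
  obtain ⟨N, hN⟩ := eventually_atTop.1 (Metric.tendstoUniformly_iff.1 hF (ε / 2) (by positivity))
  refine ⟨N, fun n hn => ?_⟩
  rw [Real.dist_0_eq_abs, Function.comp_apply, abs_of_nonneg (apply_nonneg _ _)]
  refine lt_of_le_of_lt (translationSeminorm_le _ (c := ε / 2) fun x => ?_) (by linarith)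
  rw [norm_sub_rev, ← dist_eq_norm]
  exact (hN n hn x).le

theorem IsAlmostPeriodic.precompactSeminorm {f : ℝ → ℂ} (hf : IsAlmostPeriodic f) :
    PrecompactSeminorm (translationSeminorm f hf.exists_norm_le) where
  continuous := hf.continuous_translationSeminorm
  exists_net := fun ε hε => exists_net_of_exists_cauchy_subseq (fun s => by
    obtain ⟨φ, hφ, h⟩ := hf.exists_subseq s
    exact ⟨φ, hφ, h.translationSeminorm_le _⟩) hε

theorem IsAlmostPeriodic.precompactSeminorm_add {f g : ℝ → ℂ} (hf : IsAlmostPeriodic f)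
    (hg : IsAlmostPeriodic g) :
    PrecompactSeminorm (translationSeminorm f hf.exists_norm_le
      + translationSeminorm g hg.exists_norm_le) where
  continuous := hf.continuous_translationSeminorm.add hg.continuous_translationSeminorm
  exists_net := fun ε hε => exists_net_of_exists_cauchy_subseq (fun s => by
    obtain ⟨φ, hφ, h⟩ := hf.exists_subseq s
    obtain ⟨ψ, hψ, h'⟩ := hg.exists_subseq (s ∘ φ)
    refine ⟨φ ∘ ψ, hφ.comp hψ, fun ε hε => ?_⟩
    obtain ⟨N, hN⟩ := (h.comp hψ).translationSeminorm_le hf.exists_norm_le (ε / 2) (by positivity)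
    obtain ⟨N', hN'⟩ := h'.translationSeminorm_le hg.exists_norm_le (ε / 2) (by positivity)
    refine ⟨max N N', fun m hm n hn => ?_⟩
    have h1 := hN m (le_of_max_le_left hm) n (le_of_max_le_left hn)
    have h2 := hN' m (le_of_max_le_right hm) n (le_of_max_le_right hn)
    exact (add_le_add h1 h2).trans_eq (add_halves ε)) hε

/-! ### Approximation by trigonometric polynomials with frequencies in the module -/

theorem IsAlmostPeriodic.trigApprox_top {f : ℝ → ℂ} (hf : IsAlmostPeriodic f) :
    TrigApprox ⊤ f := by
  refine hf.precompactSeminorm.trigApprox_top fun ε hε => ⟨ε, hε, fun s t hst => ?_⟩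
  have := norm_sub_le_translationSeminorm_sub hf.exists_norm_le 0 s t
  rw [zero_add, zero_add] at this
  exact this.trans_lt hst

/-- The tent function of a seminorm on the real line. -/
noncomputable def seminormTent (p : AddGroupSeminorm ℝ) (ε t : ℝ) : ℝ := max 0 (ε - p t)

theorem PrecompactSeminorm.trigApprox_seminormTent {p : AddGroupSeminorm ℝ}
    (hp : PrecompactSeminorm p) (ε : ℝ) : TrigApprox ⊤ fun t => (seminormTent p ε t : ℂ) := by
  refine hp.trigApprox_top fun η hη => ⟨η, hη, fun s t hst => ?_⟩
  rw [← Complex.ofReal_sub, Complex.norm_real, Real.norm_eq_abs, seminormTent, seminormTent,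
    max_comm 0, max_comm 0]
  refine ((abs_max_sub_max_le_abs _ _ _).trans ?_).trans_lt hst
  rw [sub_sub_sub_cancel_left, abs_sub_comm]
  exact abs_sub_map_le_sub p s t

theorem PrecompactSeminorm.continuous_seminormTent {p : AddGroupSeminorm ℝ}
    (hp : PrecompactSeminorm p) (ε : ℝ) : Continuous (seminormTent p ε) :=
  continuous_const.max (continuous_const.sub hp.continuous)

/-- Translates of the tent by a finite ε/2-net sum to at least ε/2 everywhere, and all have the same
mean m, so card · Re m ≥ ε/2. -/
theorem PrecompactSeminorm.re_mean_seminormTent_pos {p : AddGroupSeminorm ℝ}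
    (hp : PrecompactSeminorm p) {ε : ℝ} (hε : 0 < ε) {m : ℂ}
    (hm : HasMean (fun t => (seminormTent p ε t : ℂ)) m) : 0 < m.re := by
  obtain ⟨s, hs⟩ := hp.exists_net (ε / 2) (by positivity)
  have hc := hp.continuous_seminormTent ε
  have hnn : ∀ t, 0 ≤ seminormTent p ε t := fun t => le_max_left _ _
  have h1 := HasMean.sum s (F := fun y t => (seminormTent p ε (-y + t) : ℂ)) (c := fun _ => m)
    (fun y => Complex.continuous_ofReal.comp (hc.comp (by fun_prop))) (fun y => hm.comp_add (-y))
  have h2 : HasMean (fun t => ((∑ y ∈ s, seminormTent p ε (-y + t) : ℝ) : ℂ)) (∑ _y ∈ s, m) := by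
    simpa using h1
  have h3 := HasMean.norm_le_re (F := fun _ => ((ε / 2 : ℝ) : ℂ))
    (continuous_finsetSum s fun y _ => hc.comp (by fun_prop : Continuous fun t : ℝ => -y + t))
    (hasMean_const _) h2 fun t => by
      obtain ⟨y, hy, hty⟩ := hs t
      rw [Complex.norm_real, Real.norm_eq_abs, abs_of_pos (by positivity)]
      refine le_trans ?_ (Finset.single_le_sum (fun y _ => hnn (-y + t)) hy)
      rw [neg_add_eq_sub]
      exact le_max_of_le_right (by linarith)
  rw [Complex.norm_real, Real.norm_eq_abs, abs_of_pos (by positivity), Finset.sum_const,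
    Complex.re_nsmul, nsmul_eq_mul] at h3
  by_contra! hneg
  have : (s.card : ℝ) * m.re ≤ 0 := mul_nonpos_of_nonneg_of_nonpos (by positivity) hneg
  linarith

/-- Correlating a trigonometric polynomial with `f` gives a trigonometric polynomial whose
frequencies are exponents of `f`. -/
theorem TrigApprox.exists_mem_trigSpan_hasMean {f q : ℝ → ℂ} (hf : TrigApprox ⊤ f)
    (hc : Continuous f) (hq : q ∈ trigSpan ⊤) :
    ∃ P ∈ trigSpan (freqModule f), ∀ x, HasMean (fun s => q s * f (x + s)) (P x) := by
  induction hq using Submodule.span_induction with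
  | mem q hq =>
    obtain ⟨l, -, rfl⟩ := hq
    obtain ⟨d, hd⟩ := (hf.mul_of_mem (expChar_mem_trigSpan (l := l) trivial)).exists_hasMean
      (hc.mul (continuous_expChar l))
    refine ⟨d • expChar (-l), ?_, fun x => ?_⟩
    · by_cases hd0 : d = 0
      · rw [hd0, zero_smul]; exact zero_mem _
      · refine Submodule.smul_mem _ _ (expChar_mem_trigSpan (AddSubgroup.subset_closure ?_))
        refine mem_exponentSet_iff.2 ⟨d, hd0, ?_⟩
        rw [neg_neg]
        exact hd
    -- The shift s ↦ x + s turns the mean of exp(ils) f(x+s) into exp(-ilx) times d, the coefficient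
    -- of f at -l.
    · have h1 := (hd.comp_add x).const_mul (expChar (-l) x)
      have h2 : (d • expChar (-l)) x = expChar (-l) x * d := mul_comm _ _
      rw [h2]
      convert h1 using 2 with s
      rw [Pi.mul_apply, expChar_add_right]
      linear_combination (-(expChar l s * f (x + s))) * expChar_neg_mul_self l x
  | zero => exact ⟨0, zero_mem _, fun x => by simpa using hasMean_const 0⟩
  | add q r hq hr h1 h2 =>
    obtain ⟨P, hP, hP'⟩ := h1
    obtain ⟨R, hR, hR'⟩ := h2
    have hcx : ∀ x, Continuous fun s => f (x + s) := fun x => hc.comp (by fun_prop)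
    refine ⟨P + R, add_mem hP hR, fun x => ?_⟩
    have := (hP' x).add ((continuous_of_mem_trigSpan hq).mul (hcx x))
      ((continuous_of_mem_trigSpan hr).mul (hcx x)) (hR' x)
    simpa [add_mul] using this
  | smul a q hq h1 =>
    obtain ⟨P, hP, hP'⟩ := h1
    refine ⟨a • P, Submodule.smul_mem _ _ hP, fun x => ?_⟩
    simpa [mul_assoc] using (hP' x).const_mul a

/-- With φ the tent of mean m, the mean of φ(s) f(x+s) is close to m f(x), as f(x+s) is within ε of
f(x) where φ is nonzero. Replacing φ by a nearby trigonometric polynomial q makes this mean a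
trigonometric polynomial P in x with frequencies in the module, and P/m approximates f. -/
theorem IsAlmostPeriodic.trigApprox_freqModule {f : ℝ → ℂ} (hf : IsAlmostPeriodic f) :
    TrigApprox (freqModule f) f := by
  intro ε' hε'
  obtain ⟨ε, hε, rfl⟩ : ∃ ε > 0, ε' = 2 * ε := ⟨ε' / 2, by positivity, by ring⟩
  obtain ⟨B, hB⟩ := hf.exists_norm_le
  have hB0 : 0 ≤ B := (norm_nonneg _).trans (hB 0)
  set p := translationSeminorm f hf.exists_norm_le with hp
  have hpc : PrecompactSeminorm p := hf.precompactSeminorm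
  have hφc := hpc.continuous_seminormTent ε
  have hφC : Continuous fun t => (seminormTent p ε t : ℂ) := Complex.continuous_ofReal.comp hφc
  obtain ⟨m, hm⟩ := (hpc.trigApprox_seminormTent ε).exists_hasMean hφC
  have hmpos := hpc.re_mean_seminormTent_pos hε hm
  have hm0 : m ≠ 0 := fun h => by simp [h] at hmpos
  -- Replacing φ by q then costs at most ε · Re m, which stays at most ε after division by m.
  obtain ⟨q, hq, hφq⟩ := hpc.trigApprox_seminormTent ε (ε * m.re / (B + 1)) (by positivity)
  obtain ⟨P, hP, hPm⟩ := hf.trigApprox_top.exists_mem_trigSpan_hasMean hf.continuous hq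
  refine ⟨m⁻¹ • P, Submodule.smul_mem _ _ hP, fun x => ?_⟩
  set η := ε * m.re / (B + 1) with hη
  have hmean : HasMean (fun s => ((η * B + ε * seminormTent p ε s : ℝ) : ℂ))
      (((η * B : ℝ) : ℂ) + (ε : ℂ) * m) := by
    have := (hasMean_const ((η * B : ℝ) : ℂ)).add continuous_const
      (continuous_const.mul hφC) (hm.const_mul (ε : ℂ))
    simpa using this
  have hfx : Continuous fun s => f (x + s) := hf.continuous.comp (by fun_prop)
  have hdiff := (hPm x).sub ((continuous_of_mem_trigSpan hq).mul hfx)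
    (continuous_const.mul hφC) (hm.const_mul (f x))
  have hle := hdiff.norm_le_re (by fun_prop) hmean fun s => by
    have h1 : q s * f (x + s) - f x * (seminormTent p ε s : ℂ)
        = (seminormTent p ε s : ℂ) * (f (x + s) - f x)
          - ((seminormTent p ε s : ℂ) - q s) * f (x + s) := by ring
    change ‖q s * f (x + s) - f x * (seminormTent p ε s : ℂ)‖ ≤ _
    rw [h1, add_comm (η * B)]
    refine (norm_sub_le _ _).trans (add_le_add ?_ ?_)
    · have hnn : 0 ≤ seminormTent p ε s := le_max_left _ _
      rw [norm_mul, Complex.norm_real, Real.norm_eq_abs, abs_of_nonneg hnn, mul_comm]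
      rcases le_total ε (p s) with h | h
      · have : seminormTent p ε s = 0 := max_eq_left (by linarith)
        simp [this]
      · gcongr
        exact (norm_sub_le_translationSeminorm hf.exists_norm_le x s).trans h
    · rw [norm_mul]
      exact mul_le_mul (hφq s) (hB _) (norm_nonneg _) (by positivity)
  have hre : (((η * B : ℝ) : ℂ) + (ε : ℂ) * m).re = η * B + ε * m.re := by simp
  rw [hre] at hle
  have hηB : η * B ≤ ε * m.re := by
    rw [hη, div_mul_eq_mul_div, div_le_iff₀ (by positivity)]
    gcongr
    linarith
  have hmn : m.re ≤ ‖m‖ := Complex.re_le_norm m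
  have hfin : f x - (m⁻¹ • P) x = -(m⁻¹ * (P x - f x * m)) := by
    simp only [Pi.smul_apply, smul_eq_mul]
    field_simp
    ring
  rw [hfin, norm_neg, norm_mul, norm_inv, inv_mul_le_iff₀ (norm_pos_iff.2 hm0)]
  calc _ ≤ _ := hle
    _ ≤ 2 * ε * m.re := by linarith
    _ ≤ ‖m‖ * (2 * ε) := by rw [mul_comm]; gcongr

/-! ### Convergence of translates and inclusion of modules -/

/-- Translating f by a multiplies its coefficient c at l by `expChar l a`; coefficients are sup-norm
continuous and c ≠ 0. -/
theorem TranslatesConverge.exists_tendsto_expChar {f : ℝ → ℂ} (hc : Continuous f) {s : ℕ → ℝ}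
    (hs : TranslatesConverge f s) {l : ℝ} (hl : l ∈ exponentSet f) :
    ∃ z, Tendsto (fun n => expChar l (s n)) atTop (𝓝 z) := by
  obtain ⟨c, hc0, hm⟩ := mem_exponentSet_iff.1 hl
  have hmean : ∀ a, HasMean (fun t => f (t + a) * expChar (-l) t) (expChar l a * c) := fun a => by
    have h1 := (hm.comp_add a).const_mul (expChar l a)
    convert h1 using 2 with t
    rw [expChar_add_right, add_comm t a]
    linear_combination (-(f (a + t) * expChar (-l) t)) * expChar_neg_mul_self l a
  have hcont : ∀ a, Continuous fun t => f (t + a) * expChar (-l) t := fun a =>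
    (hc.comp (by fun_prop)).mul (continuous_expChar _)
  refine cauchySeq_tendsto_of_complete (Metric.cauchySeq_iff.2 fun ε hε => ?_)
  have hcn : 0 < ‖c‖ := norm_pos_iff.2 hc0
  obtain ⟨N, hN⟩ := translatesConverge_iff.1 hs (ε / 2 * ‖c‖) (by positivity)
  refine ⟨N, fun m hm n hn => ?_⟩
  have h1 := ((hmean (s m)).sub (hcont _) (hcont _) (hmean (s n))).norm_le fun t => by
    rw [← sub_mul, norm_mul, norm_expChar, mul_one]
    exact hN m hm n hn t
  rw [← sub_mul, norm_mul] at h1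
  rw [dist_eq_norm]
  linarith [le_of_mul_le_mul_right h1 hcn]

theorem exists_tendsto_expChar_of_mem_closure {S : Set ℝ} {s : ℕ → ℝ}
    (hS : ∀ l ∈ S, ∃ z, Tendsto (fun n => expChar l (s n)) atTop (𝓝 z)) {l : ℝ}
    (hl : l ∈ AddSubgroup.closure S) : ∃ z, Tendsto (fun n => expChar l (s n)) atTop (𝓝 z) := by
  induction hl using AddSubgroup.closure_induction with
  | mem l hl => exact hS l hl
  | zero => exact ⟨1, by simp⟩
  | add l m _ _ h1 h2 =>
    obtain ⟨z, hz⟩ := h1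
    obtain ⟨w, hw⟩ := h2
    exact ⟨z * w, by simpa only [expChar_add_left] using hz.mul hw⟩
  | neg l _ h =>
    obtain ⟨z, hz⟩ := h
    exact ⟨star z, by simpa only [star_expChar] using hz.star⟩

theorem translatesConverge_of_mem_trigSpan {M : AddSubgroup ℝ} {s : ℕ → ℝ}
    (hs : ∀ l ∈ M, ∃ z, Tendsto (fun n => expChar l (s n)) atTop (𝓝 z)) {q : ℝ → ℂ}
    (hq : q ∈ trigSpan M) : TranslatesConverge q s := by
  rw [translatesConverge_iff]
  induction hq using Submodule.span_induction with
  | mem q hq =>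
    obtain ⟨l, hl, rfl⟩ := hq
    obtain ⟨z, hz⟩ := hs l hl
    intro ε hε
    obtain ⟨N, hN⟩ := Metric.cauchySeq_iff.1 hz.cauchySeq ε hε
    refine ⟨N, fun m hm n hn t => ?_⟩
    rw [expChar_add_right, expChar_add_right, ← mul_sub, norm_mul, norm_expChar, one_mul,
      ← dist_eq_norm]
    exact (hN m hm n hn).le
  | zero => exact fun ε hε => ⟨0, fun _ _ _ _ t => by simpa using hε.le⟩
  | add q r _ _ h1 h2 =>
    intro ε hε
    obtain ⟨N, hN⟩ := h1 (ε / 2) (by positivity)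
    obtain ⟨N', hN'⟩ := h2 (ε / 2) (by positivity)
    refine ⟨max N N', fun m hm n hn t => ?_⟩
    rw [Pi.add_apply, Pi.add_apply, add_sub_add_comm, ← add_halves ε]
    exact (norm_add_le _ _).trans (add_le_add
      (hN m (le_of_max_le_left hm) n (le_of_max_le_left hn) t)
      (hN' m (le_of_max_le_right hm) n (le_of_max_le_right hn) t))
  | smul a q _ h =>
    intro ε hε
    obtain ⟨N, hN⟩ := h (ε / (‖a‖ + 1)) (by positivity)
    refine ⟨N, fun m hm n hn t => ?_⟩
    rw [Pi.smul_apply, Pi.smul_apply, ← smul_sub, norm_smul]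
    calc _ ≤ (‖a‖ + 1) * (ε / (‖a‖ + 1)) := by
          gcongr
          · linarith
          · exact hN m hm n hn t
      _ = ε := by field_simp

theorem TrigApprox.translatesConverge {M : AddSubgroup ℝ} {s : ℕ → ℝ}
    (hs : ∀ l ∈ M, ∃ z, Tendsto (fun n => expChar l (s n)) atTop (𝓝 z)) {h : ℝ → ℂ}
    (hh : TrigApprox M h) : TranslatesConverge h s := by
  refine translatesConverge_iff.2 fun ε hε => ?_
  obtain ⟨q, hq, hhq⟩ := hh (ε / 3) (by positivity)
  obtain ⟨N, hN⟩ := translatesConverge_iff.1 (translatesConverge_of_mem_trigSpan hs hq) (ε / 3)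
    (by positivity)
  refine ⟨N, fun m hm n hn t => ?_⟩
  have h1 := hhq (t + s m)
  have h2 := hhq (t + s n)
  have h3 := hN m hm n hn t
  rw [← dist_eq_norm] at *
  rw [dist_comm] at h2
  linarith [dist_triangle4 (h (t + s m)) (q (t + s m)) (q (t + s n)) (h (t + s n))]

/-! ### From convergence of translates to inclusion of modules -/

/-- If uniform convergence of translates of `f` and `g` forces that of translates of `h`, then `h`
is uniformly continuous for the sum of the translation seminorms of `f` and `g`. -/
theorem exists_delta_of_translatesConverge {f g h : ℝ → ℂ} (hf : ∃ B, ∀ t, ‖f t‖ ≤ B)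
    (hg : ∃ B, ∀ t, ‖g t‖ ≤ B)
    (H : ∀ s : ℕ → ℝ, TranslatesConverge f s → TranslatesConverge g s → TranslatesConverge h s) :
    ∀ ε > 0, ∃ δ > 0, ∀ s t, (translationSeminorm f hf + translationSeminorm g hg) (s - t) < δ →
      ‖h s - h t‖ < ε := by
  intro ε hε
  by_contra! hcon
  have hpos : ∀ n : ℕ, (0 : ℝ) < 1 / ((n : ℝ) + 1) := fun n => by positivity
  choose a b hab hh using fun n : ℕ => hcon (1 / ((n : ℝ) + 1)) (hpos n)
  -- Interleaving zeros forces the translates of h along a n - b n to approach h itself,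
  -- contradicting the gap ε at b n.
  let u : ℕ → ℝ := fun n => if Even n then a n - b n else 0
  have key : ∀ (k : ℝ → ℂ) (hk : ∃ B, ∀ t, ‖k t‖ ≤ B),
      (∀ n, translationSeminorm k hk (a n - b n) ≤ 1 / ((n : ℝ) + 1)) →
      TranslatesConverge k u := fun k hk hle => by
    refine ⟨k, Metric.tendstoUniformly_iff.2 fun η hη => ?_⟩
    filter_upwards [(tendsto_one_div_add_atTop_nhds_zero_nat (𝕜 := ℝ)).eventually_lt_const hη]
      with n hn t
    by_cases hev : Even n
    · simp only [u, hev, if_true]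
      rw [dist_comm, dist_eq_norm]
      exact ((norm_sub_le_translationSeminorm hk t _).trans (hle n)).trans_lt hn
    · simpa [u, hev] using hη
  have hsum : ∀ n, translationSeminorm f hf (a n - b n) + translationSeminorm g hg (a n - b n)
      < 1 / ((n : ℝ) + 1) := hab
  have hu := H u
    (key f hf fun n => by linarith [hsum n, apply_nonneg (translationSeminorm g hg) (a n - b n)])
    (key g hg fun n => by linarith [hsum n, apply_nonneg (translationSeminorm f hf) (a n - b n)])
  obtain ⟨N, hN⟩ := translatesConverge_iff.1 hu (ε / 2) (by positivity)
  have h1 := hN (2 * N) (by omega) (2 * N + 1) (by omega) (b (2 * N))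
  have h2 : u (2 * N) = a (2 * N) - b (2 * N) := by simp [u]
  have h3 : u (2 * N + 1) = 0 := by simp [u]
  rw [h2, h3, add_zero, add_sub_cancel] at h1
  linarith [hh (2 * N)]

/-- If two points of the completion are not separated by limits of trigonometric polynomials with
frequencies in `M`, then nearby points of the line are close for the translation seminorm of any
`f` that is such a limit. -/
theorem translationSeminorm_le_of_forall_extension {p : AddGroupSeminorm ℝ} {f : ℝ → ℂ}
    (hf : ∃ B, ∀ t, ‖f t‖ ≤ B) (hp : ∀ t, translationSeminorm f hf t ≤ p t)
    {M : AddSubgroup ℝ} (hM : TrigApprox M f) {x y : LineCompletion p}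
    (hxy : ∀ G : C(LineCompletion p, ℂ), TrigApprox M (fun t => G (toLineCompletion p t)) →
      G x = G y) {δ s t : ℝ} (hs : dist x (toLineCompletion p s) ≤ δ)
    (ht : dist y (toLineCompletion p t) ≤ δ) : translationSeminorm f hf (s - t) ≤ 2 * δ := by
  have hlip : ∀ z s t, ‖f (z + s) - f (z + t)‖ ≤ p (s - t) := fun z s t =>
    (norm_sub_le_translationSeminorm_sub hf z s t).trans (hp _)
  refine translationSeminorm_le hf fun z' => ?_
  obtain ⟨z, rfl⟩ : ∃ z, z' = z + t := ⟨z' - t, by ring⟩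
  rw [show z + t + (s - t) = z + s by ring]
  -- Each translate of f extends to the completion as a 1-Lipschitz function and stays approximable
  -- over M, so it takes equal values at x and y.
  obtain ⟨G, hG⟩ := exists_continuousMap_toLineCompletion (p := p) (h := fun t => f (z + t))
    fun ε hε => ⟨ε, hε, fun s t hst => (hlip z s t).trans_lt hst⟩
  have hGxy : G x = G y := hxy G (by simpa only [hG] using hM.comp_add z)
  have hGd : ∀ w r, dist (G w) (f (z + r)) ≤ dist w (toLineCompletion p r) := fun w r => by
    refine denseRange_toLineCompletion.induction_on (p := fun w =>
      dist (G w) (f (z + r)) ≤ dist w (toLineCompletion p r)) w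
      (isClosed_le (by fun_prop) (by fun_prop)) fun a => ?_
    rw [hG, dist_toLineCompletion, dist_eq_norm]
    exact hlip z a r
  have h1 := (hGd x s).trans hs
  have h2 := (hGd y t).trans ht
  rw [hGxy] at h1
  rw [← dist_eq_norm]
  linarith [dist_triangle_left (f (z + s)) (f (z + t)) (G y)]

theorem trigApprox_freqModulePair {f g h : ℝ → ℂ} (hf : IsAlmostPeriodic f)
    (hg : IsAlmostPeriodic g)
    (H : ∀ s : ℕ → ℝ, TranslatesConverge f s → TranslatesConverge g s → TranslatesConverge h s) :
    TrigApprox (freqModulePair f g) h := by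
  have hf' := hf.exists_norm_le
  have hg' := hg.exists_norm_le
  set p := translationSeminorm f hf' + translationSeminorm g hg' with hp
  have := (hf.precompactSeminorm_add hg).compactSpace
  have hfM : TrigApprox (freqModulePair f g) f :=
    hf.trigApprox_freqModule.mono (AddSubgroup.closure_mono Set.subset_union_left)
  have hgM : TrigApprox (freqModulePair f g) g :=
    hg.trigApprox_freqModule.mono (AddSubgroup.closure_mono Set.subset_union_right)
  obtain ⟨F, hF⟩ := exists_continuousMap_toLineCompletion
    (exists_delta_of_translatesConverge hf' hg' H)
  rw [← funext hF]
  refine trigApprox_comp_toLineCompletion (fun x y hxy => ?_) F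
  by_contra! hcon
  refine hxy (dist_le_zero.1 (le_of_forall_pos_le_add fun ε hε => ?_))
  -- Six shares of ε: one for each of the two approximations, and two for each of the seminorms of f
  -- and g at s - t.
  obtain ⟨s, hs⟩ := denseRange_toLineCompletion.exists_dist_lt x (show 0 < ε / 6 by positivity)
  obtain ⟨t, ht⟩ := denseRange_toLineCompletion.exists_dist_lt y (show 0 < ε / 6 by positivity)
  have h1 := translationSeminorm_le_of_forall_extension (p := p) hf'
    (fun t => le_add_of_nonneg_right (apply_nonneg _ _)) hfM hcon hs.le ht.le
  have h2 := translationSeminorm_le_of_forall_extension (p := p) hg'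
    (fun t => le_add_of_nonneg_left (apply_nonneg _ _)) hgM hcon hs.le ht.le
  have h3 : dist (toLineCompletion p s) (toLineCompletion p t)
      = translationSeminorm f hf' (s - t) + translationSeminorm g hg' (s - t) :=
    dist_toLineCompletion s t
  rw [dist_comm] at ht
  linarith [dist_triangle4 x (toLineCompletion p s) (toLineCompletion p t) y]

theorem proposition2p1 (f g h : ℝ → ℂ) (hf : IsAlmostPeriodic f) (hg : IsAlmostPeriodic g)
    (hh : IsAlmostPeriodic h) :
    freqModule h ≤ freqModulePair f g ↔
      ∀ s : ℕ → ℝ, TranslatesConverge f s → TranslatesConverge g s → TranslatesConverge h s := by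
  constructor
  · intro hle s hfs hgs
    refine hh.trigApprox_freqModule.translatesConverge fun l hl => ?_
    refine exists_tendsto_expChar_of_mem_closure (S := exponentSet f ∪ exponentSet g) ?_ (hle hl)
    rintro m (hm | hm)
    · exact hfs.exists_tendsto_expChar hf.continuous hm
    · exact hgs.exists_tendsto_expChar hg.continuous hm
  · intro H
    exact (AddSubgroup.closure_le _).2
      ((trigApprox_freqModulePair hf hg H).exponentSet_subset hh.continuous)
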